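/- Let $M,N\ge 1$ be integers, let $k$ be a field (for example $k=\mathbb{C}(q)$ with $q$ an indeterminate) and let $q\in k^\times$ be not a root of unity. **Birational action ($p=1$).** Let $\mathcal K=k(x^i_j : 1\le i\le M,\ 1\le j\le N)$, with the indices extended to $\mathbb Z$ by $x^{i+M}_j=q\,x^i_j$, $x^i_{j+N}=x^i_j$, and put $$P^i_j=\sum_{c=1}^N\ \prod_{a=1}^{c-1}x^i_{j+a}\prod_{a=c+1}^{N}x^{i+1}_{j+a}.$$ Let $\omega$ and, for $M\ge2$ and $l\in\mathbb Z/M\mathbb Z$, $r_l$ be the $k$-automorphisms of $\mathcal K$ with $\omega(x^i_j)=x^{i+1}_j$ and $$r_l(x^i_j)=x^{i+1}_j\frac{P^i_{j-1}}{P^i_j},\qquad r_l(x^{i+1}_j)=x^{i}_j\frac{P^i_{j}}{P^i_{j-1}}\qquad (i\equiv l \bmod M),$$ and $r_l(x^i_j)=x^i_j$ for $i\not\equiv l,\,l+1 \bmod M$. Products of automorphisms are compositions. Set $$\gamma_l=r_{l-1}\cdots r_1\,\omega\, r_{M-1}\cdots r_l\qquad(l=1,\dots,M).$$ **The $q$-Painlevé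 system of type $(M,N)$.** Let $F\supseteq k$ be a field with commuting $k$-automorphisms $T_1,\dots,T_M$ and nonzero elements $t_1,\dots,t_M\in F$ such that $T_m(t_m)=q\,t_m$ and $T_m(t_i)=t_i$ for $i\ne m$. For $u^{(m)}_j\in F$ ($1\le m\le M$, $1\le j\le N$) put $B_m=\mathrm{diag}(u^{(m)}_1,\dots,u^{(m)}_N)+t_m\Lambda$ with $\Lambda=\sum_{i=1}^{N-1}E_{i,i+1}+zE_{N,1}$, where $z$ is an indeterminate fixed by all $T_m$. The $q$-Painlevé system of type $(M,N)$ consists of the Zakharov–Shabat equations of the $N$-reduced modified $q$-KP hierarchy $$T_n(B_m)\,B_n=T_m(B_n)\,B_m\qquad(m,n=1,\dots,M)$$ together with the similarity constraint $$T_1\cdots T_M(u^{(m)}_j)=u^{(m)}_j\qquad(1\le m\le M,\ 1\le j\le N).$$ Call the family $u$ nondegenerate if all $u^{(m)}_j\ne0$ and, for all $m\neq n$, the vectors $t_n u^{(m)}$ and $t_m u^{(n)}$ are different (so that the system determines the time evolution). **Theorem.** Let $u$ be nondegenerate, and set $$x^i_j=\frac1{t_i}\,T_{i+1}T_{i+2}\cdots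 T_M(u^{(i)}_j)\in F .$$ Then $u$ is a solution of the $q$-Painlevé system of type $(M,N)$ if and only if, for all $l,i=1,\dots,M$ and $j=1,\dots,N$, $$T_l(x^i_j)=\gamma_l^{-1}(x^i_j),$$ where the right-hand side means that the rational function $\gamma_l^{-1}(x^i_j)\in\mathcal K$ is defined (can be written with a denominator which does not vanish) at the point $(x^i_j)$ of $F^{MN}$, and is evaluated there. -/

import Mathlib

open scoped Polynomial

namespace QPainleve

noncomputable section

/-! ### Automorphisms of a field of rational functions -/

/-- The field `k(x_s : s ∈ σ)` of rational functions. -/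
abbrev RatField (k : Type*) [Field k] (σ : Type*) : Type _ := FractionRing (MvPolynomial σ k)

/-- The variable `x_s`, as a rational function. -/
def RatField.X (k : Type*) [Field k] {σ : Type*} (s : σ) : RatField k σ :=
  algebraMap (MvPolynomial σ k) (RatField k σ) (MvPolynomial.X s)

/-- Finitely many rational functions, as many as variables, which generate the field of rational
functions are algebraically independent. -/
theorem algebraicIndependent_of_adjoin_eq_top {k σ : Type*} [Field k] [Finite σ]
    (y : σ → RatField k σ) (h : IntermediateField.adjoin k (Set.range y) = ⊤) :
    AlgebraicIndependent k y := by
  have alg : Algebra.IsAlgebraic (Algebra.adjoin k (Set.range y)) (RatField k σ) := by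
    constructor
    intro x
    have hx : x ∈ IntermediateField.adjoin k (Set.range y) := h ▸ IntermediateField.mem_top
    obtain ⟨a, ha, b, hb, rfl⟩ := IntermediateField.mem_adjoin_iff_div.mp hx
    have h1 := isAlgebraic_algebraMap (R := Algebra.adjoin k (Set.range y))
      (A := RatField k σ) (⟨a, ha⟩ : Algebra.adjoin k (Set.range y))
    have h2 := isAlgebraic_algebraMap (R := Algebra.adjoin k (Set.range y))
      (A := RatField k σ) (⟨b, hb⟩ : Algebra.adjoin k (Set.range y))
    rw [div_eq_mul_inv]
    exact h1.mul h2.inv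
  have hX : AlgebraicIndependent k (RatField.X k : σ → RatField k σ) := by
    rw [algebraicIndependent_iff_injective_aeval]
    have : (MvPolynomial.aeval (RatField.X k : σ → RatField k σ) :
        MvPolynomial σ k →ₐ[k] RatField k σ) =
        IsScalarTower.toAlgHom k (MvPolynomial σ k) (RatField k σ) := by
      ext s
      simp [RatField.X]
    rw [this]
    exact IsFractionRing.injective (MvPolynomial σ k) (RatField k σ)
  exact (Algebra.IsAlgebraic.isTranscendenceBasis_of_lift_le_trdeg_of_finite k y
    hX.lift_cardinalMk_le_trdeg).1

/-- The `k`-automorphism of the field of rational functions which replaces each variable `x_s` by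
the rational function `y_s`, where the `y_s` generate the field. -/
def substEquiv {k σ : Type*} [Field k] [Finite σ]
    (y : σ → RatField k σ) (h : IntermediateField.adjoin k (Set.range y) = ⊤) :
    RatField k σ ≃ₐ[k] RatField k σ :=
  ((algebraicIndependent_of_adjoin_eq_top y h).aevalEquivField.trans
    (IntermediateField.equivOfEq h)).trans IntermediateField.topEquiv

theorem substEquiv_X {k σ : Type*} [Field k] [Finite σ]
    (y : σ → RatField k σ) (h : IntermediateField.adjoin k (Set.range y) = ⊤) (s : σ) :
    substEquiv y h (RatField.X k s) = y s := by
  have h1 := (algebraicIndependent_of_adjoin_eq_top y h).aevalEquivField_algebraMap_apply_coe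
    (MvPolynomial.X s)
  rw [MvPolynomial.aeval_X] at h1
  exact h1

/-! ### Quasi-periodic sequences -/

/-- The sum `∑_{c=1}^N (∏_{a=1}^{c-1} A_{j+a}) (∏_{a=c+1}^N B_{j+a})`. -/
def rowSum {R : Type*} [CommSemiring R] (N : ℕ) (A B : ℤ → R) (j : ℤ) : R :=
  ∑ c ∈ Finset.Icc 1 N,
    (∏ a ∈ Finset.Ico 1 c, A (j + a)) * ∏ a ∈ Finset.Ioc c N, B (j + a)

theorem rowSum_eq_range {R : Type*} [CommSemiring R] (N : ℕ) (A B : ℤ → R) (j : ℤ) :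
    rowSum N A B j = ∑ c ∈ Finset.range N,
      (∏ a ∈ Finset.Ico 1 (c + 1), A (j + a)) * ∏ a ∈ Finset.Ioc (c + 1) N, B (j + a) := by
  unfold rowSum
  rw [← Finset.Ico_add_one_right_eq_Icc, Finset.sum_Ico_eq_sum_range]
  simp [add_comm]

theorem rowSum_recursion {K : Type*} [CommRing K] (N : ℕ) (A B : ℤ → K) (j : ℤ) :
    A (j + 1) * rowSum N A B (j + 1) - rowSum N A B j * B (j + 1 + N) =
      (∏ a ∈ Finset.Icc 1 N, A (j + a)) - ∏ a ∈ Finset.Icc 1 N, B (j + 1 + a) := by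
  let g : ℕ → K := fun c =>
    (∏ a ∈ Finset.Ico 1 (c + 1), A (j + a)) * ∏ a ∈ Finset.Ioc c N, B (j + 1 + a)
  have h1 : A (j + 1) * rowSum N A B (j + 1) = ∑ c ∈ Finset.range N, g (c + 1) := by
    rw [rowSum_eq_range, Finset.mul_sum]
    refine Finset.sum_congr rfl fun c _ => ?_
    have : ∏ a ∈ Finset.Ico 1 (c + 1 + 1), A (j + a) =
        A (j + 1) * ∏ a ∈ Finset.Ico 1 (c + 1), A (j + 1 + a) := by
      rw [Finset.prod_eq_prod_Ico_succ_bot (by omega), ← Finset.prod_Ico_add' _ 1 (c + 1) 1]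
      simp [add_comm, add_left_comm]
    simp only [g]
    rw [this]
    ring
  have h2 : rowSum N A B j * B (j + 1 + N) = ∑ c ∈ Finset.range N, g c := by
    rw [rowSum_eq_range, Finset.sum_mul]
    refine Finset.sum_congr rfl fun c hc => ?_
    have hc' : c < N := Finset.mem_range.mp hc
    have : ∏ a ∈ Finset.Ioc c N, B (j + 1 + a) =
        (∏ a ∈ Finset.Ioc (c + 1) N, B (j + a)) * B (j + 1 + N) := by
      rw [← Finset.Ico_add_one_add_one_eq_Ioc, ← Finset.Ico_add_one_add_one_eq_Ioc,
        Finset.prod_Ico_succ_top (by omega),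
        ← Finset.prod_Ico_add' _ (c + 1) N 1]
      simp [add_comm, add_left_comm]
    simp only [g]
    rw [this]
    ring
  rw [h1, h2, ← Finset.sum_sub_distrib, Finset.sum_range_sub]
  simp [g, ← Finset.Ico_add_one_right_eq_Icc, ← Finset.Ico_add_one_add_one_eq_Ioc]

theorem prod_shift {K : Type*} [Field K] (N : ℕ) (hN : 1 ≤ N) (p : K) (B : ℤ → K)
    (hB : ∀ j, B (j + N) = p * B j) (j : ℤ) (c : ℕ) :
    ∏ a ∈ Finset.Icc 1 N, B (j + c + a) = p ^ c * ∏ a ∈ Finset.Icc 1 N, B (j + a) := by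
  induction c with
  | zero => simp
  | succ c ih =>
    have key : ∏ a ∈ Finset.Icc 1 N, B (j + (c + 1 : ℕ) + a) =
        p * ∏ a ∈ Finset.Icc 1 N, B (j + c + a) := by
      rw [← Finset.Ico_add_one_right_eq_Icc]
      have e1 : ∏ a ∈ Finset.Ico 1 (N + 1), B (j + (c + 1 : ℕ) + a) =
          ∏ a ∈ Finset.Ico (1 + 1) (N + 1 + 1), B (j + c + a) := by
        rw [← Finset.prod_Ico_add' _ 1 (N + 1) 1]
        refine Finset.prod_congr rfl fun a _ => ?_
        congr 1; push_cast; ring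
      have e2 : B (j + c + (N + 1 : ℕ)) = p * B (j + c + (1 : ℕ)) := by
        rw [← hB]; congr 1; push_cast; ring
      rw [e1, Finset.prod_Ico_succ_top (by omega),
        Finset.prod_eq_prod_Ico_succ_bot (show 1 < N + 1 by omega), e2]
      ring
    rw [key, ih, pow_succ]
    ring

theorem rowSum_add_period {K : Type*} [Field K] (N : ℕ) (p : K) (A B : ℤ → K)
    (hA : ∀ j, A (j + N) = p * A j) (hB : ∀ j, B (j + N) = p * B j) (j : ℤ) :
    p * rowSum N A B (j + N) = p ^ N * rowSum N A B j := by
  unfold rowSum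
  rw [Finset.mul_sum, Finset.mul_sum]
  refine Finset.sum_congr rfl fun c hc => ?_
  obtain ⟨hc1, hc2⟩ := Finset.mem_Icc.mp hc
  have e1 : ∀ a : ℕ, A (j + N + a) = p * A (j + a) := fun a => by
    rw [← hA]; congr 1; ring
  have e2 : ∀ a : ℕ, B (j + N + a) = p * B (j + a) := fun a => by
    rw [← hB]; congr 1; ring
  simp only [e1, e2, Finset.prod_mul_distrib, Finset.prod_const, Nat.card_Ico, Nat.card_Ioc]
  have : p ^ N = p * p ^ (c - 1) * p ^ (N - c) := by
    rw [← pow_succ', ← pow_add]; congr 1; omega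
  rw [this]
  ring

theorem rowSum_swap {K : Type*} [Field K] (N : ℕ) (p : K) (hp : p ≠ 0) (A B : ℤ → K)
    (hA : ∀ j, A (j + N) = p * A j) (hB : ∀ j, B (j + N) = p * B j)
    (hP : ∀ j, rowSum N A B j ≠ 0) (j : ℤ)
    (hD : (∏ a ∈ Finset.Icc 1 N, A (j + a)) - p * ∏ a ∈ Finset.Icc 1 N, B (j + a) ≠ 0) :
    rowSum N (fun i => p * B i * (rowSum N A B (i - 1) / rowSum N A B i))
      (fun i => p⁻¹ * A i * (rowSum N A B i / rowSum N A B (i - 1))) j = rowSum N A B j := by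
  set P := rowSum N A B with hPdef
  set D := (∏ a ∈ Finset.Icc 1 N, A (j + a)) - p * ∏ a ∈ Finset.Icc 1 N, B (j + a) with hDdef
  have hN : 1 ≤ N := by
    rcases Nat.eq_zero_or_pos N with rfl | h
    · exact absurd (by simp [hPdef, rowSum]) (hP 0)
    · exact h
  have hper : p * P (j + N) = p ^ N * P j := rowSum_add_period N p A B hA hB j
  have hrec : ∀ c : ℕ, A (j + c + 1) * P (j + c + 1) - P (j + c) * (p * B (j + c + 1)) =
      p ^ c * D := by
    intro c
    have h := rowSum_recursion N A B (j + c)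
    have e : (j + c + 1 : ℤ) = j + (c + 1 : ℕ) := by push_cast; ring
    rw [hB, prod_shift N hN p A hA j c] at h
    rw [h, e, prod_shift N hN p B hB j (c + 1), hDdef]
    ring
  have t1 : ∀ c : ℕ, ∏ a ∈ Finset.Ico 1 (c + 1), (p * B (j + a) * (P (j + a - 1) / P (j + a))) =
      (∏ a ∈ Finset.Ico 1 (c + 1), (p * B (j + a))) * (P j / P (j + c)) := by
    intro c
    induction c with
    | zero => simp [hP j]
    | succ c ih =>
      rw [Finset.prod_Ico_succ_top (show 1 ≤ c + 1 by omega), ih,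
        Finset.prod_Ico_succ_top (show 1 ≤ c + 1 by omega)]
      have e : (j + (c + 1 : ℕ) - 1 : ℤ) = j + c := by push_cast; ring
      rw [e]
      have := hP (j + c)
      have := hP (j + (c + 1 : ℕ))
      field_simp
  have t2 : ∀ c : ℕ, c ≤ N → ∏ a ∈ Finset.Ioc c N, (p⁻¹ * A (j + a) * (P (j + a) / P (j + a - 1))) =
      (∏ a ∈ Finset.Ioc c N, (p⁻¹ * A (j + a))) * (P (j + N) / P (j + c)) := by
    intro c hc
    induction hc using Nat.decreasingInduction with
    | self => simp [hP (j + N)]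
    | of_succ c hc ih =>
      have hc' : c < N := hc
      rw [← Finset.Ico_add_one_add_one_eq_Ioc] at ih
      rw [← Finset.Ico_add_one_add_one_eq_Ioc,
        Finset.prod_eq_prod_Ico_succ_bot (show c + 1 < N + 1 by omega), ih,
        Finset.prod_eq_prod_Ico_succ_bot (show c + 1 < N + 1 by omega)]
      have e : (j + (c + 1 : ℕ) - 1 : ℤ) = j + c := by push_cast; ring
      rw [e]
      have := hP (j + c)
      have := hP (j + (c + 1 : ℕ))
      field_simp
  let h : ℕ → K := fun c => (∏ a ∈ Finset.Ico 1 (c + 1), (p * B (j + a))) *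
    (∏ a ∈ Finset.Ioc c N, A (j + a)) / P (j + c)
  have key : D * rowSum N (fun i => p * B i * (P (i - 1) / P i))
      (fun i => p⁻¹ * A i * (P i / P (i - 1))) j =
      ∑ c ∈ Finset.range N, (P j) ^ 2 * (h c - h (c + 1)) := by
    rw [rowSum_eq_range, Finset.mul_sum]
    refine Finset.sum_congr rfl fun c hc => ?_
    have hc' : c < N := Finset.mem_range.mp hc
    rw [t1, t2 _ hc']
    have e3 : ∏ a ∈ Finset.Ioc c N, A (j + a) =
        A (j + c + 1) * ∏ a ∈ Finset.Ioc (c + 1) N, A (j + a) := by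
      rw [← Finset.Ico_add_one_add_one_eq_Ioc, ← Finset.Ico_add_one_add_one_eq_Ioc,
        Finset.prod_eq_prod_Ico_succ_bot (by omega)]
      push_cast
      simp only [add_assoc]
    have e4 : ∏ a ∈ Finset.Ico 1 (c + 1 + 1), (p * B (j + a)) =
        (∏ a ∈ Finset.Ico 1 (c + 1), (p * B (j + a))) * (p * B (j + c + 1)) := by
      rw [Finset.prod_Ico_succ_top (by omega)]
      push_cast
      rw [add_assoc]
    simp only [h]
    rw [e3, e4, Finset.prod_mul_distrib (s := Finset.Ioc (c + 1) N), Finset.prod_const,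
      Nat.card_Ioc]
    have hr := hrec c
    have e5 : (j + (c + 1 : ℕ) : ℤ) = j + c + 1 := by push_cast; ring
    rw [e5]
    have q1 := hP (j + c)
    have q2 := hP (j + c + 1)
    have hPN : P (j + N) = p ^ c * p ^ (N - (c + 1)) * P j := by
      apply mul_left_cancel₀ hp
      rw [hper, ← pow_add, ← mul_assoc, ← pow_succ']
      congr 2
      omega
    rw [hPN]
    have q3 : (p⁻¹) ^ (N - (c + 1)) * p ^ (N - (c + 1)) = 1 := by
      rw [← mul_pow, inv_mul_cancel₀ hp, one_pow]
    generalize (∏ a ∈ Finset.Ico 1 (c + 1), (p * B (j + a))) = U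
    generalize (∏ a ∈ Finset.Ioc (c + 1) N, A (j + a)) = V
    have lhs : D * (U * (P j / P (j + c)) * ((p⁻¹) ^ (N - (c + 1)) * V *
        (p ^ c * p ^ (N - (c + 1)) * P j / P (j + c + 1)))) =
        ((p⁻¹) ^ (N - (c + 1)) * p ^ (N - (c + 1))) * ((p ^ c * D) * U * V * P j ^ 2 /
          (P (j + c) * P (j + c + 1))) := by
      field_simp
    rw [lhs, q3, ← hr]
    field_simp
  rw [← Finset.mul_sum, Finset.sum_range_sub'] at key
  apply mul_left_cancel₀ hD
  rw [key]
  have h0 : h 0 = (∏ a ∈ Finset.Icc 1 N, A (j + a)) / P j := by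
    simp [h, ← Finset.Ico_add_one_right_eq_Icc, ← Finset.Ico_add_one_add_one_eq_Ioc]
  have h1 : h N = p * (∏ a ∈ Finset.Icc 1 N, B (j + a)) / P j := by
    simp only [h, Finset.Ioc_self, Finset.prod_empty, mul_one, Finset.prod_mul_distrib,
      Finset.prod_const, Finset.Ico_add_one_right_eq_Icc]
    rw [div_eq_div_iff (hP _) (hP _)]
    rw [Nat.card_Icc, Nat.add_sub_cancel]
    linear_combination (-∏ a ∈ Finset.Icc 1 N, B (j + a)) * hper
  rw [h0, h1, hDdef]
  have := hP j
  field_simp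

/-! ### The birational action on the space of `M × N` matrices

The labels `i, j` of the variables run over `1, …, M` and `1, …, N`; the
variable with the labels `(i, j)` is the generator `RatField.X k (a, b)` with `i = a + 1` and `j = b + 1`. -/

/-- The element of `Fin M` which stands for the label `i`, read modulo `M`. -/
def idx (M : ℕ) [NeZero M] (i : ℤ) : Fin M :=
  ⟨((i - 1) % M).toNat, by
    have hM : (0 : ℤ) < M := by exact_mod_cast Nat.pos_of_ne_zero (NeZero.ne M)
    have := Int.emod_nonneg (i - 1) hM.ne'
    have := Int.emod_lt_of_pos (i - 1) hM
    omega⟩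

/-- The variables `x^i_j`, extended to all `i, j ∈ ℤ` by `x^{i+M}_j = q x^i_j` and
`x^i_{j+N} = p x^i_j`. -/
def xx {k : Type*} [Field k] (M N : ℕ) [NeZero M] [NeZero N] (q p : kˣ) (i j : ℤ) :
    RatField k (Fin M × Fin N) :=
  algebraMap k (RatField k (Fin M × Fin N)) ((q ^ ((i - 1) / M) * p ^ ((j - 1) / N) : kˣ) : k) *
    RatField.X k (idx M i, idx N j)

/-- `P^i_j = ∑_{c=1}^N (∏_{a=1}^{c-1} x^i_{j+a}) (∏_{a=c+1}^N x^{i+1}_{j+a})`. -/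
def PP {k : Type*} [Field k] (M N : ℕ) [NeZero M] [NeZero N] (q p : kˣ) (i j : ℤ) :
    RatField k (Fin M × Fin N) :=
  rowSum N (xx M N q p i) (xx M N q p (i + 1)) j

/-- The rational function `r_l(x^i_j)`. -/
def rImage {k : Type*} [Field k] (M N : ℕ) [NeZero M] [NeZero N] (q p : kˣ) (l i j : ℤ) :
    RatField k (Fin M × Fin N) :=
  if i ≡ l [ZMOD M] then
    algebraMap k _ (p : k) * xx M N q p (i + 1) j * (PP M N q p i (j - 1) / PP M N q p i j)
  else if i ≡ l + 1 [ZMOD M] then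
    algebraMap k _ ((p⁻¹ : kˣ) : k) * xx M N q p (i - 1) j *
      (PP M N q p (i - 1) j / PP M N q p (i - 1) (j - 1))
  else xx M N q p i j

section aux

set_option linter.unusedSectionVars false

variable {k : Type*} [Field k] (M N : ℕ) [NeZero M] [NeZero N] (q p : kˣ)

theorem idx_add (i : ℤ) : idx M (i + M) = idx M i := by
  ext
  have : (i + M - 1 : ℤ) % M = (i - 1) % M := by
    rw [show (i + M - 1 : ℤ) = i - 1 + M by ring, Int.add_emod_right]
  simp [idx, this]

theorem idx_label (a : Fin M) : idx M ((a : ℕ) + 1 : ℤ) = a := by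
  ext
  have : ((a : ℕ) : ℤ) % M = (a : ℕ) :=
    Int.emod_eq_of_lt (by positivity) (by exact_mod_cast a.2)
  simp [idx, this]

theorem xx_label (a : Fin M) (b : Fin N) :
    xx M N q p ((a : ℕ) + 1) ((b : ℕ) + 1) = RatField.X k (a, b) := by
  have h1 : ((a : ℕ) : ℤ) / M = 0 :=
    Int.ediv_eq_zero_of_lt (by positivity) (by exact_mod_cast a.2)
  have h2 : ((b : ℕ) : ℤ) / N = 0 :=
    Int.ediv_eq_zero_of_lt (by positivity) (by exact_mod_cast b.2)
  simp [xx, idx_label, h1, h2]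

theorem xx_add_left (i j : ℤ) :
    xx M N q p (i + M) j = algebraMap k _ (q : k) * xx M N q p i j := by
  have hM : (M : ℤ) ≠ 0 := by exact_mod_cast NeZero.ne M
  have : (i + M - 1 : ℤ) / M = (i - 1) / M + 1 := by
    rw [show (i + M - 1 : ℤ) = i - 1 + M by ring, Int.add_ediv_of_dvd_right (dvd_refl _),
      Int.ediv_self hM]
  rw [xx, xx, idx_add, this, zpow_add_one, ← mul_assoc (algebraMap k _ _), ← map_mul]
  congr 2
  push_cast
  ring

theorem xx_add_right (i j : ℤ) :
    xx M N q p i (j + N) = algebraMap k _ (p : k) * xx M N q p i j := by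
  have hN : (N : ℤ) ≠ 0 := by exact_mod_cast NeZero.ne N
  have : (j + N - 1 : ℤ) / N = (j - 1) / N + 1 := by
    rw [show (j + N - 1 : ℤ) = j - 1 + N by ring, Int.add_ediv_of_dvd_right (dvd_refl _),
      Int.ediv_self hN]
  rw [xx, xx, idx_add, this, zpow_add_one, ← mul_assoc (algebraMap k _ _), ← map_mul]
  congr 2
  push_cast
  ring

theorem algebraMap_unit_ne_zero (c : kˣ) :
    algebraMap k (RatField k (Fin M × Fin N)) (c : k) ≠ 0 := by
  simp

theorem not_modEq_add_one (hM : 2 ≤ M) (i : ℤ) : ¬ (i + 1 ≡ i [ZMOD M]) := by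
  intro h
  have h1 : (M : ℤ) ∣ 1 := by simpa using h.symm.dvd
  have := Int.le_of_dvd one_pos h1
  omega

theorem idx_eq_iff (i i' : ℤ) : idx M i = idx M i' ↔ i ≡ i' [ZMOD M] := by
  have hM : (0 : ℤ) < M := by exact_mod_cast Nat.pos_of_ne_zero (NeZero.ne M)
  have h1 := Int.emod_nonneg (i - 1) hM.ne'
  have h2 := Int.emod_nonneg (i' - 1) hM.ne'
  have : idx M i = idx M i' ↔ i - 1 ≡ i' - 1 [ZMOD M] := by
    rw [Fin.ext_iff, Int.ModEq]
    simp only [idx]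
    omega
  rw [this]
  constructor
  · intro h
    simpa using h.add_right 1
  · intro h
    exact h.sub_right 1

/-- The variables and their multiples, as polynomials. -/
def xpoly (i j : ℤ) : MvPolynomial (Fin M × Fin N) k :=
  MvPolynomial.C ((q ^ ((i - 1) / M) * p ^ ((j - 1) / N) : kˣ) : k) *
    MvPolynomial.X (idx M i, idx N j)

theorem algebraMap_xpoly (i j : ℤ) :
    algebraMap _ (RatField k (Fin M × Fin N)) (xpoly M N q p i j) = xx M N q p i j := by
  rw [xpoly, map_mul, xx, RatField.X, ← MvPolynomial.algebraMap_eq,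
    ← IsScalarTower.algebraMap_apply]

/-- Evaluation at the matrix whose row `i` is `(1, …, 1)` and whose other rows vanish. -/
def evalRow (i : ℤ) : MvPolynomial (Fin M × Fin N) k →+* k :=
  MvPolynomial.eval fun s => if s.1 = idx M i then 1 else 0

theorem evalRow_self (i j : ℤ) : evalRow M N i (xpoly M N q p i j) ≠ 0 := by
  simp only [evalRow, xpoly, map_mul, MvPolynomial.eval_C, MvPolynomial.eval_X, if_true, mul_one]
  exact Units.ne_zero _

theorem evalRow_succ (hM : 2 ≤ M) (i j : ℤ) : evalRow M N i (xpoly M N q p (i + 1) j) = 0 := by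
  have : ¬ idx M (i + 1) = idx M i := by
    rw [idx_eq_iff]
    exact not_modEq_add_one M hM i
  simp [evalRow, xpoly, this]

theorem algebraMap_ne_zero_of_evalRow (i : ℤ) (f : MvPolynomial (Fin M × Fin N) k)
    (hf : evalRow M N i f ≠ 0) : algebraMap _ (RatField k (Fin M × Fin N)) f ≠ 0 := by
  intro h
  have : f = 0 := IsFractionRing.injective (MvPolynomial (Fin M × Fin N) k)
    (RatField k (Fin M × Fin N)) (by rw [h, map_zero])
  exact hf (by rw [this, map_zero])

theorem PP_ne_zero (hM : 2 ≤ M) (i j : ℤ) : PP M N q p i j ≠ 0 := by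
  have hN : 1 ≤ N := Nat.pos_of_ne_zero (NeZero.ne N)
  have h1 : PP M N q p i j =
      algebraMap _ _ (rowSum N (xpoly M N q p i) (xpoly M N q p (i + 1)) j) := by
    simp only [PP, rowSum, map_sum, map_mul, map_prod, algebraMap_xpoly]
  rw [h1]
  apply algebraMap_ne_zero_of_evalRow M N i
  simp only [rowSum, map_sum, map_mul, map_prod, evalRow_succ M N q p hM]
  rw [Finset.sum_eq_single N]
  · simp only [Finset.Ioc_self, Finset.prod_empty, mul_one]
    exact Finset.prod_ne_zero_iff.mpr fun a _ => evalRow_self M N q p i _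
  · intro c hc hcN
    have := Finset.mem_Icc.mp hc
    rw [Finset.prod_const, Nat.card_Ioc, zero_pow (by omega), mul_zero]
  · intro h
    exact absurd (Finset.mem_Icc.mpr ⟨hN, le_rfl⟩) h

theorem discr_ne_zero (hM : 2 ≤ M) (i j : ℤ) :
    (∏ a ∈ Finset.Icc 1 N, xx M N q p i (j + a)) -
      algebraMap k _ (p : k) * ∏ a ∈ Finset.Icc 1 N, xx M N q p (i + 1) (j + a) ≠ 0 := by
  have hN : 1 ≤ N := Nat.pos_of_ne_zero (NeZero.ne N)
  have h1 : (∏ a ∈ Finset.Icc 1 N, xx M N q p i (j + a)) -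
      algebraMap k _ (p : k) * ∏ a ∈ Finset.Icc 1 N, xx M N q p (i + 1) (j + a) =
      algebraMap _ _ ((∏ a ∈ Finset.Icc 1 N, xpoly M N q p i (j + a)) -
        MvPolynomial.C (p : k) * ∏ a ∈ Finset.Icc 1 N, xpoly M N q p (i + 1) (j + a)) := by
    rw [map_sub, map_mul, map_prod, map_prod, ← MvPolynomial.algebraMap_eq,
      ← IsScalarTower.algebraMap_apply]
    simp only [algebraMap_xpoly]
  rw [h1]
  apply algebraMap_ne_zero_of_evalRow M N i
  rw [map_sub, map_mul, map_prod, map_prod]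
  simp only [evalRow_succ M N q p hM, Finset.prod_const, Nat.card_Icc, Nat.add_sub_cancel]
  rw [zero_pow (by omega), mul_zero, sub_zero]
  exact Finset.prod_ne_zero_iff.mpr fun a _ => evalRow_self M N q p i _

theorem eq_top_of_X_mem {σ : Type*} (L : IntermediateField k (RatField k σ))
    (h : ∀ s, RatField.X k s ∈ L) : L = ⊤ := by
  have hpoly : ∀ f : MvPolynomial σ k, algebraMap _ (RatField k σ) f ∈ L := by
    intro f
    induction f using MvPolynomial.induction_on with
    | C c =>
      rw [← MvPolynomial.algebraMap_eq, ← IsScalarTower.algebraMap_apply]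
      exact L.algebraMap_mem c
    | add f g hf hg => rw [map_add]; exact L.add_mem hf hg
    | mul_X f s hf => rw [map_mul]; exact L.mul_mem hf (h s)
  rw [eq_top_iff]
  intro x _
  obtain ⟨a, b, _, rfl⟩ := IsFractionRing.div_surjective (A := MvPolynomial σ k) x
  exact L.div_mem (hpoly a) (hpoly b)

/-- A field which contains the values at the labels `1, …, M` and `1, …, N` of a quasi-periodic
family contains all its values. -/
theorem mem_of_quasiperiodic (L : IntermediateField k (RatField k (Fin M × Fin N)))
    (f : ℤ → ℤ → RatField k (Fin M × Fin N))
    (hq : ∀ i j, f (i + M) j = algebraMap k _ (q : k) * f i j)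
    (hp : ∀ i j, f i (j + N) = algebraMap k _ (p : k) * f i j)
    (h : ∀ (a : Fin M) (b : Fin N), f ((a : ℕ) + 1) ((b : ℕ) + 1) ∈ L) (i j : ℤ) : f i j ∈ L := by
  have cancel : ∀ (c : kˣ) (y : RatField k (Fin M × Fin N)),
      algebraMap k _ (c : k) * y ∈ L ↔ y ∈ L := by
    intro c y
    refine ⟨fun hy => ?_, fun hy => L.mul_mem (L.algebraMap_mem _) hy⟩
    have := L.mul_mem (L.algebraMap_mem ((c⁻¹ : kˣ) : k)) hy
    rwa [← mul_assoc, ← map_mul, Units.inv_mul, map_one, one_mul] at this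
  have hqz : ∀ (n i j : ℤ), f (i + M * n) j ∈ L ↔ f i j ∈ L := by
    intro n i j
    induction n using Int.induction_on with
    | zero => simp
    | succ n ih =>
      rw [show i + M * ((n : ℤ) + 1) = i + M * n + M by ring, hq, cancel, ih]
    | pred n ih =>
      rw [← ih, show i + M * (-(n : ℤ)) = i + M * (-(n : ℤ) - 1) + M by ring, hq, cancel]
  have hpz : ∀ (n i j : ℤ), f i (j + N * n) ∈ L ↔ f i j ∈ L := by
    intro n i j
    induction n using Int.induction_on with
    | zero => simp
    | succ n ih =>
      rw [show j + N * ((n : ℤ) + 1) = j + N * n + N by ring, hp, cancel, ih]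
    | pred n ih =>
      rw [← ih, show j + N * (-(n : ℤ)) = j + N * (-(n : ℤ) - 1) + N by ring, hp, cancel]
  have hM : (0 : ℤ) < M := by exact_mod_cast Nat.pos_of_ne_zero (NeZero.ne M)
  have hN : (0 : ℤ) < N := by exact_mod_cast Nat.pos_of_ne_zero (NeZero.ne N)
  have e1 : i = ((idx M i : ℕ) + 1 : ℤ) + M * ((i - 1) / M) := by
    have := Int.emod_add_mul_ediv (i - 1) M
    have := Int.emod_nonneg (i - 1) hM.ne'
    simp only [idx]
    omega
  have e2 : j = ((idx N j : ℕ) + 1 : ℤ) + N * ((j - 1) / N) := by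
    have := Int.emod_add_mul_ediv (j - 1) N
    have := Int.emod_nonneg (j - 1) hN.ne'
    simp only [idx]
    omega
  rw [e1, e2, hqz, hpz]
  exact h _ _

theorem PP_ratio_left (i j j' : ℤ) :
    PP M N q p (i + M) j / PP M N q p (i + M) j' = PP M N q p i j / PP M N q p i j' := by
  have h : ∀ j, PP M N q p (i + M) j = algebraMap k _ (q : k) ^ (N - 1) * PP M N q p i j := by
    intro j
    unfold PP rowSum
    rw [Finset.mul_sum]
    refine Finset.sum_congr rfl fun c hc => ?_
    have hc' := Finset.mem_Icc.mp hc
    rw [show i + (M : ℤ) + 1 = i + 1 + M by ring]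
    simp only [xx_add_left, Finset.prod_mul_distrib, Finset.prod_const, Nat.card_Ico, Nat.card_Ioc]
    rw [show N - 1 = (c - 1) + (N - c) by omega, pow_add]
    ring
  rw [h, h, mul_div_mul_left _ _ (pow_ne_zero _ (algebraMap_unit_ne_zero M N q))]

theorem PP_ratio_right (i j j' : ℤ) :
    PP M N q p i (j + N) / PP M N q p i (j' + N) = PP M N q p i j / PP M N q p i j' := by
  have h : ∀ j, PP M N q p i (j + N) = (algebraMap k _ (p : k))⁻¹ *
      algebraMap k _ (p : k) ^ N * PP M N q p i j := by
    intro j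
    have := rowSum_add_period N (algebraMap k _ (p : k)) (xx M N q p i) (xx M N q p (i + 1))
      (xx_add_right M N q p i) (xx_add_right M N q p (i + 1)) j
    have hp := algebraMap_unit_ne_zero M N p
    rw [mul_assoc, eq_inv_mul_iff_mul_eq₀ hp]
    exact this
  rw [h, h, mul_div_mul_left]
  exact mul_ne_zero (inv_ne_zero (algebraMap_unit_ne_zero M N p))
    (pow_ne_zero _ (algebraMap_unit_ne_zero M N p))

theorem rImage_add_left (l i j : ℤ) :
    rImage M N q p l (i + M) j = algebraMap k _ (q : k) * rImage M N q p l i j := by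
  have h : ∀ l : ℤ, (i + M ≡ l [ZMOD M]) ↔ (i ≡ l [ZMOD M]) := by
    intro l
    simp [Int.ModEq]
  unfold rImage
  simp only [h]
  rw [show i + (M : ℤ) + 1 = i + 1 + M by ring, show i + (M : ℤ) - 1 = i - 1 + M by ring,
    PP_ratio_left, PP_ratio_left, xx_add_left, xx_add_left, xx_add_left]
  split_ifs <;> ring

theorem rImage_add_right (l i j : ℤ) :
    rImage M N q p l i (j + N) = algebraMap k _ (p : k) * rImage M N q p l i j := by
  unfold rImage
  rw [show j + (N : ℤ) - 1 = j - 1 + N by ring,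
    PP_ratio_right, PP_ratio_right, xx_add_right, xx_add_right, xx_add_right]
  split_ifs <;> ring

theorem rImage_generate (hM : 2 ≤ M) (l : ℤ) :
    IntermediateField.adjoin k (Set.range fun s : Fin M × Fin N =>
      rImage M N q p l ((s.1 : ℕ) + 1) ((s.2 : ℕ) + 1)) = ⊤ := by
  set L := IntermediateField.adjoin k (Set.range fun s : Fin M × Fin N =>
      rImage M N q p l ((s.1 : ℕ) + 1) ((s.2 : ℕ) + 1)) with hL
  have hy : ∀ i j, rImage M N q p l i j ∈ L := by
    apply mem_of_quasiperiodic M N q p L _ (rImage_add_left M N q p l) (rImage_add_right M N q p l)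
    intro a b
    exact IntermediateField.subset_adjoin _ _ ⟨(a, b), rfl⟩
  have hp := algebraMap_unit_ne_zero M N p
  -- the two rows which `r_l` changes
  have hpair : ∀ i, i ≡ l [ZMOD M] → ∀ j, xx M N q p i j ∈ L ∧ xx M N q p (i + 1) j ∈ L := by
    intro i hi
    have hi1 : ¬ (i + 1 ≡ l [ZMOD M]) := fun h =>
      not_modEq_add_one M hM i (h.trans hi.symm)
    have hi2 : i + 1 ≡ l + 1 [ZMOD M] := hi.add_right 1
    have hA : ∀ j, rImage M N q p l i j = algebraMap k _ (p : k) * xx M N q p (i + 1) j *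
        (PP M N q p i (j - 1) / PP M N q p i j) := fun j => by
      rw [rImage, if_pos hi]
    have hB : ∀ j, rImage M N q p l (i + 1) j = (algebraMap k _ (p : k))⁻¹ * xx M N q p i j *
        (PP M N q p i j / PP M N q p i (j - 1)) := fun j => by
      rw [rImage, if_neg hi1, if_pos hi2, add_sub_cancel_right, Units.val_inv_eq_inv_val, map_inv₀]
    have hP0 := PP_ne_zero M N q p hM i
    have hPL : ∀ j, PP M N q p i j ∈ L := by
      intro j
      have hsw := rowSum_swap N (algebraMap k _ (p : k)) hp (xx M N q p i) (xx M N q p (i + 1))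
        (xx_add_right M N q p i) (xx_add_right M N q p (i + 1)) hP0 j
        (discr_ne_zero M N q p hM i j)
      have hrw : PP M N q p i j =
          rowSum N (rImage M N q p l i) (rImage M N q p l (i + 1)) j := by
        rw [funext hA, funext hB]
        exact hsw.symm
      rw [hrw]
      exact L.sum_mem fun c _ => L.mul_mem (L.prod_mem fun a _ => hy _ _)
        (L.prod_mem fun a _ => hy _ _)
    intro j
    have q1 := hP0 j
    have q2 := hP0 (j - 1)
    constructor
    · have : xx M N q p i j = algebraMap k _ (p : k) * rImage M N q p l (i + 1) j *
          (PP M N q p i (j - 1) / PP M N q p i j) := by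
        rw [hB]
        field_simp
      rw [this]
      exact L.mul_mem (L.mul_mem (L.algebraMap_mem _) (hy _ _)) (L.div_mem (hPL _) (hPL _))
    · have : xx M N q p (i + 1) j = (algebraMap k _ (p : k))⁻¹ * rImage M N q p l i j *
          (PP M N q p i j / PP M N q p i (j - 1)) := by
        rw [hA]
        field_simp
      rw [this]
      exact L.mul_mem (L.mul_mem (L.inv_mem (L.algebraMap_mem _)) (hy _ _))
        (L.div_mem (hPL _) (hPL _))
  apply eq_top_of_X_mem
  rintro ⟨a, b⟩
  rw [← xx_label M N q p a b]
  by_cases h1 : ((a : ℕ) + 1 : ℤ) ≡ l [ZMOD M]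
  · exact (hpair _ h1 _).1
  by_cases h2 : ((a : ℕ) + 1 : ℤ) ≡ l + 1 [ZMOD M]
  · have := (hpair ((a : ℕ) + 1 - 1 : ℤ) (by simpa using h2.sub_right 1) ((b : ℕ) + 1)).2
    rwa [sub_add_cancel] at this
  · have := hy ((a : ℕ) + 1) ((b : ℕ) + 1)
    rwa [rImage, if_neg h1, if_neg h2] at this

theorem shift_generate :
    IntermediateField.adjoin k (Set.range fun s : Fin M × Fin N =>
      xx M N q p ((s.1 : ℕ) + 1 + 1) ((s.2 : ℕ) + 1)) = ⊤ := by
  set L := IntermediateField.adjoin k (Set.range fun s : Fin M × Fin N =>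
      xx M N q p ((s.1 : ℕ) + 1 + 1) ((s.2 : ℕ) + 1)) with hL
  have hy : ∀ i j, xx M N q p (i + 1) j ∈ L := by
    apply mem_of_quasiperiodic M N q p L (fun i j => xx M N q p (i + 1) j)
    · intro i j
      rw [show i + (M : ℤ) + 1 = i + 1 + M by ring, xx_add_left]
    · intro i j
      exact xx_add_right M N q p (i + 1) j
    · intro a b
      exact IntermediateField.subset_adjoin _ _ ⟨(a, b), rfl⟩
  apply eq_top_of_X_mem
  rintro ⟨a, b⟩
  rw [← xx_label M N q p a b]
  have := hy ((a : ℕ) + 1 - 1) ((b : ℕ) + 1)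
  rwa [sub_add_cancel] at this

end aux

/-- The automorphism `r_l` (`l ∈ ℤ/Mℤ`) of the field of rational functions in the `x^i_j`. For
`M = 1` there are no reflections, and the value `1` is never used. -/
def r {k : Type*} [Field k] (M N : ℕ) [NeZero M] [NeZero N] (q p : kˣ) (l : ℤ) :
    RatField k (Fin M × Fin N) ≃ₐ[k] RatField k (Fin M × Fin N) :=
  if hM : 2 ≤ M then
    substEquiv (fun s => rImage M N q p l ((s.1 : ℕ) + 1) ((s.2 : ℕ) + 1))
      (rImage_generate M N q p hM l)
  else 1

/-- The automorphism `ω`, with `ω(x^i_j) = x^{i+1}_j`. -/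
def omega {k : Type*} [Field k] (M N : ℕ) [NeZero M] [NeZero N] (q p : kˣ) :
    RatField k (Fin M × Fin N) ≃ₐ[k] RatField k (Fin M × Fin N) :=
  substEquiv (fun s => xx M N q p ((s.1 : ℕ) + 1 + 1) ((s.2 : ℕ) + 1))
    (shift_generate M N q p)

/-- The product `r_{a+n-1} ⋯ r_{a+1} r_a` of `n` automorphisms. -/
def rDesc {k : Type*} [Field k] (M N : ℕ) [NeZero M] [NeZero N] (q p : kˣ) (a : ℕ) :
    ℕ → (RatField k (Fin M × Fin N) ≃ₐ[k] RatField k (Fin M × Fin N))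
  | 0 => 1
  | n + 1 => r M N q p ((a + n : ℕ) : ℤ) * rDesc M N q p a n

/-- `γ_l = r_{l-1} ⋯ r_1 ω r_{M-1} ⋯ r_l`, for `l = 1, …, M`. -/
def gamma {k : Type*} [Field k] (M N : ℕ) [NeZero M] [NeZero N] (q p : kˣ) (l : ℕ) :
    RatField k (Fin M × Fin N) ≃ₐ[k] RatField k (Fin M × Fin N) :=
  rDesc M N q p 1 (l - 1) * omega M N q p * rDesc M N q p l (M - l)

/-- The rational function `f` is defined at the point `a`, with coordinates in an extension field,
and has the value `v` there. -/
def HasValueAt {k σ F : Type*} [Field k] [Field F] [Algebra k F]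
    (f : RatField k σ) (a : σ → F) (v : F) : Prop :=
  ∃ n d : MvPolynomial σ k,
    MvPolynomial.aeval a d ≠ 0 ∧
    f = algebraMap (MvPolynomial σ k) (RatField k σ) n /
      algebraMap (MvPolynomial σ k) (RatField k σ) d ∧
    v = MvPolynomial.aeval a n / MvPolynomial.aeval a d

/-! ### The `q`-Painlevé system -/

/-- The cyclic matrix `Λ = ∑_{i=1}^{N-1} E_{i,i+1} + z E_{N,1}`, over `F[z]`. -/
def cyc (F : Type*) [Field F] (N : ℕ) : Matrix (Fin N) (Fin N) F[X] :=
  Matrix.of fun a b =>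
    (if (a : ℕ) + 1 = b then 1 else 0) +
      (if (a : ℕ) + 1 = N ∧ (b : ℕ) = 0 then Polynomial.X else 0)

/-- The matrix `B_m = diag(u^{(m)}) + t_m Λ`. -/
def BB {F : Type*} [Field F] {M N : ℕ} (t : Fin M → F) (u : Fin M → Fin N → F) (m : Fin M) :
    Matrix (Fin N) (Fin N) F[X] :=
  Matrix.diagonal (fun j => Polynomial.C (u m j)) + Polynomial.C (t m) • cyc F N

/-- An automorphism of `F` acts on matrices over `F[z]`, leaving `z` fixed. -/
def act {k F : Type*} [Field k] [Field F] [Algebra k F] {N : ℕ} (τ : F ≃ₐ[k] F)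
    (A : Matrix (Fin N) (Fin N) F[X]) : Matrix (Fin N) (Fin N) F[X] :=
  A.map (Polynomial.map (τ : F →+* F))

/-- The `u^{(m)}_j` solve the `q`-Painlevé system of type `(M, N)`: the Zakharov–Shabat equations
`T_n(B_m) B_n = T_m(B_n) B_m` and the similarity constraint `T_1 ⋯ T_M (u^{(m)}_j) = u^{(m)}_j`. -/
structure IsSolution {k F : Type*} [Field k] [Field F] [Algebra k F] {M N : ℕ}
    (T : Fin M → (F ≃ₐ[k] F)) (t : Fin M → F) (u : Fin M → Fin N → F) : Prop where
  zakharovShabat : ∀ m n, act (T n) (BB t u m) * BB t u n = act (T m) (BB t u n) * BB t u m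
  similarity : ∀ m j, ((List.finRange M).map T).prod (u m j) = u m j

/-- The solution is nondegenerate: no `u^{(m)}_j` vanishes, and for `m ≠ n` the vectors
`t_n u^{(m)}` and `t_m u^{(n)}` are different. -/
structure Nondegenerate {F : Type*} [Field F] {M N : ℕ}
    (t : Fin M → F) (u : Fin M → Fin N → F) : Prop where
  ne_zero : ∀ m j, u m j ≠ 0
  ne : ∀ m n, m ≠ n → ∃ j, t n * u m j ≠ t m * u n j

/-- `x^i_j = t_i⁻¹ T_{i+1} T_{i+2} ⋯ T_M (u^{(i)}_j)`. -/
def xvar {k F : Type*} [Field k] [Field F] [Algebra k F] {M N : ℕ}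
    (T : Fin M → (F ≃ₐ[k] F)) (t : Fin M → F) (u : Fin M → Fin N → F) (s : Fin M × Fin N) : F :=
  (t s.1)⁻¹ * (((List.finRange M).filter (s.1 < ·)).map T).prod (u s.1 s.2)

end

end QPainleve

namespace QPainleve

noncomputable section

/-! ### Periodic rows and their exchange -/

section Rows

variable {K : Type*} [Field K]

/-! Count rows from 0 and put `U_i = u^{(i)} / t_i`, extended periodically in `j`. For `m ≠ n` the
Zakharov–Shabat equation says `(T_n U_m + Λ)(U_n + Λ) = (T_m U_n + Λ)(U_m + Λ)`, and the similarity
constraint says that the product of all `T_i` multiplies each `U_m` by `q⁻¹`. On the other side, the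
birational reflection replaces two rows `A, B` by `C, D` with `(A + Λ)(B + Λ) = (C + Λ)(D + Λ)` and
with the period products (the determinants, up to the term in `z`) interchanged. So both sides of
the theorem speak of refactorizations.

From the system to the translations: nondegeneracy forces a refactorization to interchange the
period products (`Refactors.periodProd_eq`), so `e_m = ∏ U_m` is fixed by `T_n` for `n ≠ m`, and
similarity gives `T_m e_m = q^{-N} e_m`. Since `q^N ≠ 1`, the `e_m` are distinct, and each
refactorization is the birational exchange (`Refactors.isSwap`). Applying products of the `T_i`
turns these exchanges into the steps of `γ_l⁻¹`: row `l` is carried to the end, multiplied by `q⁻¹`,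
and carried from the beginning back to its place (`isTranslation_of_refactors`).

From the translations to the system: `γ_l` acts on the row products by scalars, so their behaviour
under `T_l`, and hence their distinctness, can be read off (`periodProd_eq_of_mapsPoint`).
Distinctness makes every exchange invertible, and it shows that if the composite `γ_l⁻¹` is defined
at the point then so is every exchange on the way (`exists_isTranslation`). The rows met on the way
are then identified by comparing two factorizations of one long product of rows: a last factor is
determined by its determinant if that differs from the determinants of the other factors
(`eq_of_foldr_rowOp_eq`, `IsTranslation.comp_after_eq`). With these rows known, the exchanges are
the Zakharov–Shabat equations and the rotation step is the similarity constraint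
(`refactors_of_isTranslation`). -/

/-- The product of the entries of a row over one period. -/
def periodProd (N : ℕ) (A : ℤ → K) : K := ∏ a ∈ Finset.Icc 1 N, A a

theorem prod_Icc_add {N : ℕ} {A : ℤ → K} (hA : Function.Periodic A (N : ℤ)) (j : ℤ) :
    ∏ a ∈ Finset.Icc 1 N, A (j + a) = periodProd N A := by
  rcases Nat.eq_zero_or_pos N with rfl | hN
  · simp [periodProd]
  have h1 : ∀ j : ℤ, ∏ a ∈ Finset.Icc 1 N, A (j + 1 + a) = ∏ a ∈ Finset.Icc 1 N, A (j + a) := by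
    intro j
    have := prod_shift N hN 1 A (fun j => by rw [hA, one_mul]) j 1
    simpa using this
  induction j using Int.induction_on with
  | zero => simp [periodProd]
  | succ n ih => rw [h1, ih]
  | pred n ih => rw [← ih, ← h1, sub_add_cancel]

theorem rowSum_periodic {N : ℕ} {A B : ℤ → K} (hA : Function.Periodic A (N : ℤ))
    (hB : Function.Periodic B (N : ℤ)) : Function.Periodic (rowSum N A B) (N : ℤ) := by
  intro j
  have := rowSum_add_period N 1 A B (fun j => by rw [hA, one_mul]) (fun j => by rw [hB, one_mul]) j
  simpa using this

/-- The boundary products of `rowSum_recursion` become full periods, so the right side does not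
depend on `j`. Comparing neighbouring `j` gives the sum rule of `Refactors`. -/
theorem rowSum_recursion_of_periodic {N : ℕ} {A B : ℤ → K} (hA : Function.Periodic A (N : ℤ))
    (hB : Function.Periodic B (N : ℤ)) (j : ℤ) :
    A j * rowSum N A B j - rowSum N A B (j - 1) * B j = periodProd N A - periodProd N B := by
  have := rowSum_recursion N A B (j - 1)
  rwa [sub_add_cancel, hB, prod_Icc_add hA, prod_Icc_add hB] at this

/-- The equality `(A + Λ)(B + Λ) = (C + Λ)(D + Λ)`, in terms of the entries of the rows. -/
structure Refactors (A B C D : ℤ → K) : Prop where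
  mul : ∀ j, A j * B j = C j * D j
  add : ∀ j, A j + B (j + 1) = C j + D (j + 1)

theorem Refactors.symm {A B C D : ℤ → K} (h : Refactors A B C D) : Refactors C D A B :=
  ⟨fun j => (h.mul j).symm, fun j => (h.add j).symm⟩

theorem refactors_comp {L S : Type*} [Field L] [FunLike S K L] [RingHomClass S K L] (f : S)
    {A B C D : ℤ → K} : Refactors (f ∘ A) (f ∘ B) (f ∘ C) (f ∘ D) ↔ Refactors A B C D := by
  have hf : Function.Injective f := (f : K →+* L).injective
  constructor
  · intro h
    constructor
    · intro j
      apply hf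
      simpa using h.mul j
    · intro j
      apply hf
      simpa using h.add j
  · intro h
    constructor
    · intro j
      simp only [Function.comp_apply, ← map_mul, h.mul j]
    · intro j
      simp only [Function.comp_apply, ← map_add, h.add j]

/-- The rows `C, D` arise from `A, B` by the birational exchange, which is defined at `A, B`. -/
structure IsSwap (N : ℕ) (A B C D : ℤ → K) : Prop where
  ne_zero : ∀ j, rowSum N A B j ≠ 0
  left : ∀ j, C j = B j * (rowSum N A B (j - 1) / rowSum N A B j)
  right : ∀ j, D j = A j * (rowSum N A B j / rowSum N A B (j - 1))

theorem IsSwap.comp {L S : Type*} [Field L] [FunLike S K L] [RingHomClass S K L] (f : S) {N : ℕ}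
    {A B C D : ℤ → K} (h : IsSwap N A B C D) : IsSwap N (f ∘ A) (f ∘ B) (f ∘ C) (f ∘ D) := by
  have e : ∀ j, rowSum N (f ∘ A) (f ∘ B) j = f (rowSum N A B j) := by
    intro j
    simp [rowSum, map_sum, map_mul, map_prod]
  refine ⟨fun j => ?_, fun j => ?_, fun j => ?_⟩
  · rw [e]
    exact (map_ne_zero f).mpr (h.ne_zero j)
  · simp [e, h.left j]
  · simp [e, h.right j]

namespace IsSwap

variable {N : ℕ} {A B C D : ℤ → K}

theorem periodic_left (h : IsSwap N A B C D) (hA : Function.Periodic A (N : ℤ))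
    (hB : Function.Periodic B (N : ℤ)) : Function.Periodic C (N : ℤ) := by
  have hP := rowSum_periodic hA hB
  intro j
  rw [h.left, h.left, hB, hP, show j + (N : ℤ) - 1 = j - 1 + N by ring, hP]

theorem periodic_right (h : IsSwap N A B C D) (hA : Function.Periodic A (N : ℤ))
    (hB : Function.Periodic B (N : ℤ)) : Function.Periodic D (N : ℤ) := by
  have hP := rowSum_periodic hA hB
  intro j
  rw [h.right, h.right, hA, hP, show j + (N : ℤ) - 1 = j - 1 + N by ring, hP]

/-- The correction factors of the two rows are inverse to each other, whence the product rule; the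
sum rule is the difference of the recursion at `j` and at `j + 1`. -/
theorem refactors (h : IsSwap N A B C D) (hA : Function.Periodic A (N : ℤ))
    (hB : Function.Periodic B (N : ℤ)) : Refactors A B C D := by
  refine ⟨fun j => ?_, fun j => ?_⟩
  · rw [h.left, h.right]
    have := h.ne_zero j
    have := h.ne_zero (j - 1)
    field_simp
  · have r1 := rowSum_recursion_of_periodic hA hB j
    have r2 := rowSum_recursion_of_periodic hA hB (j + 1)
    have h1 := h.ne_zero j
    rw [h.left, h.right]
    rw [add_sub_cancel_right] at r2 ⊢
    field_simp
    linear_combination r1 - r2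

theorem ne_zero_right (h : IsSwap N A B C D) (hA : ∀ j, A j ≠ 0) (j : ℤ) : D j ≠ 0 := by
  rw [h.right]
  exact mul_ne_zero (hA j) (div_ne_zero (h.ne_zero _) (h.ne_zero _))

/-- The correction factors cancel over one period. With `periodProd_right`: an exchange interchanges
the determinants of the two rows. -/
theorem periodProd_left (h : IsSwap N A B C D) (hA : Function.Periodic A (N : ℤ))
    (hB : Function.Periodic B (N : ℤ)) : periodProd N C = periodProd N B := by
  have hP := rowSum_periodic hA hB
  have e : periodProd N (fun j => rowSum N A B (j - 1)) = periodProd N (rowSum N A B) := by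
    rw [← prod_Icc_add hP (-1)]
    exact Finset.prod_congr rfl fun a _ => by simp only [sub_eq_neg_add]
  have hne : periodProd N (rowSum N A B) ≠ 0 :=
    Finset.prod_ne_zero_iff.mpr fun a _ => h.ne_zero _
  have : periodProd N C = periodProd N B *
      (periodProd N (fun j => rowSum N A B (j - 1)) / periodProd N (rowSum N A B)) := by
    simp only [periodProd, h.left, Finset.prod_mul_distrib, Finset.prod_div_distrib]
  rw [this, e, div_self hne, mul_one]

theorem periodProd_right (h : IsSwap N A B C D) (hA : Function.Periodic A (N : ℤ))
    (hB : Function.Periodic B (N : ℤ)) : periodProd N D = periodProd N A := by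
  have hP := rowSum_periodic hA hB
  have e : periodProd N (fun j => rowSum N A B (j - 1)) = periodProd N (rowSum N A B) := by
    rw [← prod_Icc_add hP (-1)]
    exact Finset.prod_congr rfl fun a _ => by simp only [sub_eq_neg_add]
  have hne : periodProd N (rowSum N A B) ≠ 0 :=
    Finset.prod_ne_zero_iff.mpr fun a _ => h.ne_zero _
  have : periodProd N D = periodProd N A *
      (periodProd N (rowSum N A B) / periodProd N (fun j => rowSum N A B (j - 1))) := by
    simp only [periodProd, h.right, Finset.prod_mul_distrib, Finset.prod_div_distrib]
  rw [this, e, div_self hne, mul_one]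

/-- The sums in the denominators are invariant under the exchange, so it is an involution. The
invariance comes from `rowSum_swap`, which cancels the difference of the period products; hence
`hAB`. -/
theorem symm (h : IsSwap N A B C D) (hA : Function.Periodic A (N : ℤ))
    (hB : Function.Periodic B (N : ℤ)) (hAB : periodProd N A ≠ periodProd N B) :
    IsSwap N C D A B := by
  have e : ∀ j, rowSum N C D j = rowSum N A B j := by
    intro j
    have := rowSum_swap N 1 one_ne_zero A B (fun j => by rw [hA, one_mul])
      (fun j => by rw [hB, one_mul]) h.ne_zero j
      (by rw [prod_Icc_add hA, prod_Icc_add hB, one_mul]; exact sub_ne_zero.mpr hAB)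
    rw [← this]
    simp only [one_mul, inv_one]
    rw [show C = fun i => B i * (rowSum N A B (i - 1) / rowSum N A B i) from funext h.left,
      show D = fun i => A i * (rowSum N A B i / rowSum N A B (i - 1)) from funext h.right]
  refine ⟨fun j => by rw [e]; exact h.ne_zero j, fun j => ?_, fun j => ?_⟩
  · have := h.ne_zero j
    have := h.ne_zero (j - 1)
    rw [e, e, h.right]
    field_simp
  · have := h.ne_zero j
    have := h.ne_zero (j - 1)
    rw [e, e, h.left]
    field_simp

end IsSwap

/-- If the quotients in the exchange take values at `A, B`, then the denominators do not vanish. -/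
theorem rowSum_ne_zero_of_mul_eq {N : ℕ} {A B : ℤ → K} (hA : Function.Periodic A (N : ℤ))
    (hB : Function.Periodic B (N : ℤ)) (hAB : periodProd N A ≠ periodProd N B) (j : ℤ) (v : K)
    (hv : v * rowSum N A B j = B j * rowSum N A B (j - 1)) : rowSum N A B j ≠ 0 := by
  intro h0
  have h := rowSum_recursion_of_periodic hA hB j
  apply hAB
  -- At a zero of the sum, `B j * rowSum N A B (j - 1)` is zero by `hv`, and up to sign the
  -- difference of the period products by the recursion.
  rw [h0] at hv h
  linear_combination -h + hv

/-! ### Refactorizations that interchange the determinants are exchanges. -/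

section Converse

variable {N : ℕ} {A B C D : ℤ → K}

/-- A zero propagates forward and, by periodicity, reaches every index. -/
theorem forall_ne_zero_of_step [NeZero N] {d : ℤ → K} (hd : Function.Periodic d (N : ℤ))
    (hstep : ∀ j, d j = 0 → d (j + 1) = 0) {i : ℤ} (hi : d i ≠ 0) (j : ℤ) : d j ≠ 0 := by
  intro h0
  have h1 : ∀ n : ℕ, d (j + n) = 0 := by
    intro n
    induction n with
    | zero => simpa using h0
    | succ n ih => simpa [add_assoc] using hstep _ ih
  apply hi
  have hN : (0 : ℤ) < N := by exact_mod_cast Nat.pos_of_ne_zero (NeZero.ne N)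
  have e := h1 ((i - j) % N).toNat
  rw [Int.toNat_of_nonneg (Int.emod_nonneg _ hN.ne')] at e
  have h2 := hd.int_mul ((i - j) / N) (j + (i - j) % N)
  rw [e] at h2
  rw [← h2]
  congr 1
  have := Int.emod_add_mul_ediv (i - j) N
  push_cast
  linarith [mul_comm ((i - j) / (N : ℤ)) N]

theorem periodProd_ne_zero (hA : ∀ j, A j ≠ 0) : periodProd N A ≠ 0 :=
  Finset.prod_ne_zero_iff.mpr fun _ _ => hA _

/-- Eliminating `C` leaves a first-order linear recursion for `D - B`. -/
theorem Refactors.mul_sub (h : Refactors A B C D) (j : ℤ) :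
    A j * (D j - B j) = (D (j + 1) - B (j + 1)) * D j := by
  linear_combination h.add j * D j - h.mul j

theorem Refactors.sub_ne_zero [NeZero N] (h : Refactors A B C D)
    (hB : Function.Periodic B (N : ℤ)) (hD : Function.Periodic D (N : ℤ))
    (hD0 : ∀ j, D j ≠ 0) (hne : D ≠ B) (j : ℤ) : D j - B j ≠ 0 := by
  obtain ⟨i, hi⟩ := Function.ne_iff.mp hne
  refine forall_ne_zero_of_step (N := N) (d := fun j => D j - B j) (fun j => by simp only [hB j, hD j])
    (fun j hj => ?_) (_root_.sub_ne_zero.mpr hi) j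
  have := h.mul_sub j
  rw [show D j - B j = 0 from hj, mul_zero] at this
  exact (mul_eq_zero.mp this.symm).resolve_right (hD0 j)

/-- Multiply `mul_sub` over a period and cancel the differences, none of which vanishes. This is
where nondegeneracy, as `D ≠ B`, excludes the trivial refactorization. -/
theorem Refactors.periodProd_eq [NeZero N] (h : Refactors A B C D)
    (hB : Function.Periodic B (N : ℤ)) (hD : Function.Periodic D (N : ℤ))
    (hD0 : ∀ j, D j ≠ 0) (hne : D ≠ B) : periodProd N A = periodProd N D := by
  have h1 := h.sub_ne_zero hB hD hD0 hne
  have hper : Function.Periodic (fun j => D j - B j) (N : ℤ) := fun j => by simp only [hB j, hD j]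
  have e : periodProd N A * periodProd N (fun j => D j - B j) =
      periodProd N (fun j => D (j + 1) - B (j + 1)) * periodProd N D := by
    simp only [periodProd, ← Finset.prod_mul_distrib]
    exact Finset.prod_congr rfl fun a _ => h.mul_sub a
  have e2 : periodProd N (fun j => D (j + 1) - B (j + 1)) = periodProd N (fun j => D j - B j) := by
    rw [← prod_Icc_add hper 1]
    exact Finset.prod_congr rfl fun a _ => by simp only [add_comm]
  rw [e2, mul_comm] at e
  exact mul_left_cancel₀ (periodProd_ne_zero h1) e

/-- A second factorization with different factors is the one found by the exchange. -/
theorem Refactors.isSwap [NeZero N] (h : Refactors A B C D)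
    (hB : Function.Periodic B (N : ℤ)) (hD : Function.Periodic D (N : ℤ))
    (hD0 : ∀ j, D j ≠ 0) (hBD : periodProd N D ≠ periodProd N B) : IsSwap N A B C D := by
  have hne : D ≠ B := fun e => hBD (by rw [e])
  have h1 := h.sub_ne_zero hB hD hD0 hne
  -- `A` and `C` are `D` and `B` times the same ratio of consecutive values of `D - B`, so products
  -- of the `A j` telescope.
  have hA : ∀ j, A j = D j * ((D (j + 1) - B (j + 1)) / (D j - B j)) := by
    intro j
    have := h1 j
    field_simp
    linear_combination h.mul_sub j
  have hC : ∀ j, C j = B j * ((D (j + 1) - B (j + 1)) / (D j - B j)) := by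
    intro j
    apply mul_right_cancel₀ (hD0 j)
    rw [← h.mul j, hA]
    ring
  have hprod : ∀ (j : ℤ) (c : ℕ), ∏ a ∈ Finset.Ico 1 (c + 1), A (j + a) =
      (∏ a ∈ Finset.Ico 1 (c + 1), D (j + a)) *
        ((D (j + c + 1) - B (j + c + 1)) / (D (j + 1) - B (j + 1))) := by
    intro j c
    induction c with
    | zero => simp [h1 (j + 1)]
    | succ c ih =>
      rw [Finset.prod_Ico_succ_top (show 1 ≤ c + 1 by omega),
        Finset.prod_Ico_succ_top (show 1 ≤ c + 1 by omega), ih, hA]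
      have := h1 (j + 1)
      have := h1 (j + c + 1)
      push_cast
      rw [← add_assoc j (c : ℤ) 1]
      field_simp
  have hP : ∀ j, rowSum N A B j =
      (periodProd N D - periodProd N B) / (D (j + 1) - B (j + 1)) := by
    intro j
    have h2 := h1 (j + 1)
    -- `g` interpolates between the period product of `B` at `c = 0` and that of `D` at `c = N`; the
    -- terms of `rowSum` are its increments over a common denominator.
    let g : ℕ → K := fun c => (∏ a ∈ Finset.Ico 1 (c + 1), D (j + a)) *
      ∏ a ∈ Finset.Ioc c N, B (j + a)
    have key : rowSum N A B j = ∑ c ∈ Finset.range N,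
        (g (c + 1) - g c) / (D (j + 1) - B (j + 1)) := by
      rw [rowSum_eq_range]
      refine Finset.sum_congr rfl fun c hc => ?_
      have hc' : c < N := Finset.mem_range.mp hc
      have e1 : ∏ a ∈ Finset.Ioc c N, B (j + a) =
          B (j + c + 1) * ∏ a ∈ Finset.Ioc (c + 1) N, B (j + a) := by
        rw [← Finset.Ico_add_one_add_one_eq_Ioc, ← Finset.Ico_add_one_add_one_eq_Ioc,
          Finset.prod_eq_prod_Ico_succ_bot (by omega)]
        push_cast
        simp only [add_assoc]
      have e2 : ∏ a ∈ Finset.Ico 1 (c + 1 + 1), D (j + a) =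
          (∏ a ∈ Finset.Ico 1 (c + 1), D (j + a)) * D (j + c + 1) := by
        rw [Finset.prod_Ico_succ_top (by omega)]
        push_cast
        rw [add_assoc]
      simp only [g]
      rw [hprod, e1, e2]
      field_simp
    rw [key, ← Finset.sum_div, Finset.sum_range_sub]
    congr 1
    simp only [g, Finset.Ioc_self, Finset.prod_empty, mul_one]
    rw [Finset.Ico_add_one_right_eq_Icc, prod_Icc_add hD, ← Finset.Ico_add_one_add_one_eq_Ioc]
    simp only [zero_add, Finset.Ico_self, Finset.prod_empty, one_mul]
    rw [Finset.Ico_add_one_right_eq_Icc, prod_Icc_add hB]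
  have h3 := _root_.sub_ne_zero.mpr hBD
  refine ⟨fun j => by rw [hP]; exact div_ne_zero h3 (h1 _), fun j => ?_, fun j => ?_⟩
  · have := h1 j
    have := h1 (j + 1)
    rw [hP, hP, hC, sub_add_cancel]
    field_simp
  · have := h1 j
    have := h1 (j + 1)
    rw [hP, hP, hA, sub_add_cancel]
    field_simp

end Converse

/-! ### Kernels of products -/

/-- The difference operator `A + Λ` on sequences. -/
def rowOp (A v : ℤ → K) (j : ℤ) : K := A j * v j + v (j + 1)

/-- Reading rows as operators makes it possible to compare products of many rows. -/
theorem Refactors.rowOp_rowOp {A B C D : ℤ → K} (h : Refactors A B C D) (v : ℤ → K) :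
    rowOp A (rowOp B v) = rowOp C (rowOp D v) := by
  funext j
  simp only [rowOp]
  linear_combination v j * h.mul j + v (j + 1) * h.add j

theorem rowOp_quasiperiodic {N : ℕ} {A v : ℤ → K} {c : K} (hA : Function.Periodic A (N : ℤ))
    (hv : ∀ j, v (j + N) = c * v j) (j : ℤ) : rowOp A v (j + N) = c * rowOp A v j := by
  simp only [rowOp]
  rw [hA, hv, show j + (N : ℤ) + 1 = j + 1 + N by ring, hv]
  ring

theorem add_nat_of_rowOp_eq_zero {A v : ℤ → K} (h : ∀ j, rowOp A v j = 0) (j : ℤ) (n : ℕ) :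
    v (j + 1 + n) = (-1) ^ n * (∏ a ∈ Finset.Icc 1 n, A (j + a)) * v (j + 1) := by
  induction n with
  | zero => simp
  | succ n ih =>
    rw [← Finset.Ico_add_one_right_eq_Icc] at ih
    rw [← Finset.Ico_add_one_right_eq_Icc, Finset.prod_Ico_succ_top (by omega)]
    have := h (j + 1 + n)
    simp only [rowOp] at this
    have e : v (j + 1 + (n + 1 : ℕ)) = -(A (j + 1 + n) * v (j + 1 + n)) := by
      rw [show (j + 1 + (n + 1 : ℕ) : ℤ) = j + 1 + n + 1 by push_cast; ring]
      linear_combination this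
    rw [e, ih, show (j + (n + 1 : ℕ) : ℤ) = j + 1 + n by push_cast; ring]
    ring

/-- Over one period a kernel vector of `A + Λ` is multiplied by `(-1) ^ N * periodProd N A`; hence
the operator is injective on sequences with any other multiplier. -/
theorem eq_zero_of_rowOp_eq_zero {N : ℕ} {A v : ℤ → K} {e : K}
    (hA : Function.Periodic A (N : ℤ)) (he : periodProd N A ≠ e)
    (hv : ∀ j, v (j + N) = (-1) ^ N * e * v j) (h : ∀ j, rowOp A v j = 0) (j : ℤ) : v j = 0 := by
  have h1 := add_nat_of_rowOp_eq_zero h (j - 1) N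
  rw [sub_add_cancel, hv, prod_Icc_add hA] at h1
  have h2 : ((-1) ^ N * (e - periodProd N A)) * v j = 0 := by linear_combination h1
  refine (mul_eq_zero.mp h2).resolve_left (mul_ne_zero ?_ (sub_ne_zero.mpr he.symm))
  exact pow_ne_zero _ (neg_ne_zero.mpr one_ne_zero)

/-- Periodic rows preserve the multiplier of a sequence, so the factors can be cancelled one at a
time from the outside. -/
theorem eq_zero_of_foldr_rowOp_eq_zero {N : ℕ} {e : K} (L : List (ℤ → K))
    (hL : ∀ A ∈ L, Function.Periodic A (N : ℤ) ∧ periodProd N A ≠ e) {v : ℤ → K}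
    (hv : ∀ j, v (j + N) = (-1) ^ N * e * v j) (h : ∀ j, L.foldr rowOp v j = 0) (j : ℤ) :
    v j = 0 := by
  induction L generalizing j with
  | nil => exact h j
  | cons A L ih =>
    have hq : ∀ j, L.foldr rowOp v (j + N) = (-1) ^ N * e * L.foldr rowOp v j := by
      have hL' : ∀ A ∈ L, Function.Periodic A (N : ℤ) :=
        fun B hB => (hL B (List.mem_cons_of_mem _ hB)).1
      clear ih h hL
      induction L with
      | nil => exact hv
      | cons B L ih =>
        exact rowOp_quasiperiodic (hL' B List.mem_cons_self)
          (ih fun C hC => hL' C (List.mem_cons_of_mem _ hC))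
    refine ih (fun B hB => hL B (List.mem_cons_of_mem _ hB)) (fun j => ?_) j
    obtain ⟨h1, h2⟩ := hL A List.mem_cons_self
    exact eq_zero_of_rowOp_eq_zero h1 h2 hq h j

/-- A row of nonzero entries annihilates a sequence without zeros. -/
theorem exists_rowOp_eq_zero {A : ℤ → K} (hA : ∀ j, A j ≠ 0) :
    ∃ v : ℤ → K, (∀ j, rowOp A v j = 0) ∧ ∀ j, v j ≠ 0 := by
  let f : ℤ → K := fun j => -A j
  have hf : ∀ j, f j ≠ 0 := fun j => neg_ne_zero.mpr (hA j)
  -- The solution of `v (j + 1) = -A j * v j` with `v 0 = 1`. Truncation by `toNat` leaves one of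
  -- the two products empty, according to the sign of `j`.
  let v : ℤ → K := fun j => (∏ a ∈ Finset.range j.toNat, f a) /
    ∏ a ∈ Finset.range (-j).toNat, f (-(a + 1 : ℕ))
  have hv : ∀ j, v (j + 1) = f j * v j := by
    intro j
    rcases le_or_gt 0 j with hj | hj
    · obtain ⟨n, rfl⟩ := Int.eq_ofNat_of_zero_le hj
      have e1 : ((n : ℤ) + 1).toNat = n + 1 := by omega
      have e2 : (-((n : ℤ) + 1)).toNat = 0 := by omega
      have e3 : (-(n : ℤ)).toNat = 0 := by omega
      simp only [v, e1, e2, e3, Int.toNat_natCast, Finset.prod_range_succ, Finset.range_zero,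
        Finset.prod_empty, div_one]
      ring
    · obtain ⟨n, hn⟩ := Int.eq_ofNat_of_zero_le (show 0 ≤ -j - 1 by omega)
      have e1 : (j + 1).toNat = 0 := by omega
      have e2 : (-(j + 1)).toNat = n := by omega
      have e3 : (-j).toNat = n + 1 := by omega
      have e4 : j.toNat = 0 := by omega
      have e5 : (-((n + 1 : ℕ) : ℤ)) = j := by push_cast; omega
      have h1 : ∏ a ∈ Finset.range n, f (-(a + 1 : ℕ)) ≠ 0 :=
        Finset.prod_ne_zero_iff.mpr fun a _ => hf _
      simp only [v, e1, e2, e3, e4, Finset.prod_range_succ, Finset.range_zero, Finset.prod_empty]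
      rw [e5]
      have := hf j
      field_simp
  refine ⟨v, fun j => ?_, fun j => ?_⟩
  · simp only [rowOp, hv, f]
    ring
  · exact div_ne_zero (Finset.prod_ne_zero_iff.mpr fun a _ => hf _)
      (Finset.prod_ne_zero_iff.mpr fun a _ => hf _)

/-- The last factor of a product of rows is determined by its determinant. -/
theorem eq_of_foldr_rowOp_eq {N : ℕ} {A B : ℤ → K} (hA : Function.Periodic A (N : ℤ))
    (hB : Function.Periodic B (N : ℤ)) (hA0 : ∀ j, A j ≠ 0) (L L' : List (ℤ → K))
    (hL : ∀ C ∈ L, Function.Periodic C (N : ℤ) ∧ periodProd N C ≠ periodProd N A)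
    (h : ∀ v, L'.foldr rowOp (rowOp A v) = L.foldr rowOp (rowOp B v)) : B = A := by
  obtain ⟨v, hv, hv0⟩ := exists_rowOp_eq_zero hA0
  have hz : ∀ L : List (ℤ → K), L.foldr rowOp (0 : ℤ → K) = 0 := by
    intro L
    induction L with
    | nil => rfl
    | cons C L ih =>
      rw [List.foldr_cons, ih]
      funext j
      simp [rowOp]
  have hvq : ∀ j, v (j + N) = (-1) ^ N * periodProd N A * v j := by
    intro j
    have h1 := add_nat_of_rowOp_eq_zero hv (j - 1) N
    rwa [sub_add_cancel, prod_Icc_add hA] at h1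
  -- `L` kills `rowOp B v`, whose multiplier is that of the kernel of `A` and is excluded for each
  -- factor of `L`. So `B` kills `v` as well, and `v` has no zeros.
  have h1 := h v
  rw [show rowOp A v = 0 from funext hv, hz] at h1
  have h2 := eq_zero_of_foldr_rowOp_eq_zero L hL (rowOp_quasiperiodic hB hvq)
    (fun j => (congrFun h1 j).symm)
  funext j
  apply mul_right_cancel₀ (hv0 j)
  have h3 := hv j
  have h4 := h2 j
  simp only [rowOp] at h3 h4
  linear_combination h4 - h3

end Rows

/-! ### Values of rational functions -/

section Values

variable {k σ F : Type*} [Field k] [Field F] [Algebra k F]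

namespace HasValueAt

variable {a : σ → F} {f g : RatField k σ} {v w : F}

theorem ne_zero_of_aeval {d : MvPolynomial σ k} (hd : MvPolynomial.aeval a d ≠ 0) :
    algebraMap (MvPolynomial σ k) (RatField k σ) d ≠ 0 := by
  intro h
  have : d = 0 := IsFractionRing.injective (MvPolynomial σ k) (RatField k σ) (by rw [h, map_zero])
  exact hd (by rw [this, map_zero])

theorem const (c : k) (a : σ → F) :
    HasValueAt (algebraMap k (RatField k σ) c) a (algebraMap k F c) := by
  refine ⟨MvPolynomial.C c, 1, by simp, ?_, by simp⟩
  rw [map_one, div_one, ← MvPolynomial.algebraMap_eq, ← IsScalarTower.algebraMap_apply]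

theorem X (s : σ) (a : σ → F) : HasValueAt (RatField.X k s) a (a s) :=
  ⟨MvPolynomial.X s, 1, by simp, by simp [RatField.X], by simp⟩

theorem add (hf : HasValueAt f a v) (hg : HasValueAt g a w) : HasValueAt (f + g) a (v + w) := by
  obtain ⟨n, d, hd, rfl, rfl⟩ := hf
  obtain ⟨n', d', hd', rfl, rfl⟩ := hg
  have := ne_zero_of_aeval hd
  have := ne_zero_of_aeval hd'
  refine ⟨n * d' + n' * d, d * d', by simp [hd, hd'], ?_, ?_⟩
  · simp only [map_add, map_mul]
    field_simp
  · simp only [map_add, map_mul]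
    field_simp

theorem mul (hf : HasValueAt f a v) (hg : HasValueAt g a w) : HasValueAt (f * g) a (v * w) := by
  obtain ⟨n, d, hd, rfl, rfl⟩ := hf
  obtain ⟨n', d', hd', rfl, rfl⟩ := hg
  refine ⟨n * n', d * d', by simp [hd, hd'], ?_, ?_⟩
  · simp only [map_mul, div_mul_div_comm]
  · simp only [map_mul, div_mul_div_comm]

theorem inv (hf : HasValueAt f a v) (hv : v ≠ 0) : HasValueAt f⁻¹ a v⁻¹ := by
  obtain ⟨n, d, hd, rfl, rfl⟩ := hf
  refine ⟨d, n, fun h => hv (by rw [h, zero_div]), ?_, ?_⟩ <;> rw [inv_div]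

theorem div (hf : HasValueAt f a v) (hg : HasValueAt g a w) (hw : w ≠ 0) :
    HasValueAt (f / g) a (v / w) := by
  rw [div_eq_mul_inv, div_eq_mul_inv]
  exact hf.mul (hg.inv hw)

theorem sum {ι : Type*} (s : Finset ι) {f : ι → RatField k σ} {v : ι → F}
    (h : ∀ i ∈ s, HasValueAt (f i) a (v i)) : HasValueAt (∑ i ∈ s, f i) a (∑ i ∈ s, v i) := by
  classical
  induction s using Finset.induction_on with
  | empty => simpa using HasValueAt.const (0 : k) a
  | insert i s hi ih =>
    rw [Finset.sum_insert hi, Finset.sum_insert hi]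
    exact (h i (Finset.mem_insert_self _ _)).add
      (ih fun j hj => h j (Finset.mem_insert_of_mem hj))

theorem prod {ι : Type*} (s : Finset ι) {f : ι → RatField k σ} {v : ι → F}
    (h : ∀ i ∈ s, HasValueAt (f i) a (v i)) : HasValueAt (∏ i ∈ s, f i) a (∏ i ∈ s, v i) := by
  classical
  induction s using Finset.induction_on with
  | empty => simpa using HasValueAt.const (1 : k) a
  | insert i s hi ih =>
    rw [Finset.prod_insert hi, Finset.prod_insert hi]
    exact (h i (Finset.mem_insert_self _ _)).mul
      (ih fun j hj => h j (Finset.mem_insert_of_mem hj))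

theorem rowSum {N : ℕ} {A B : ℤ → RatField k σ} {A' B' : ℤ → F}
    (hA : ∀ j, HasValueAt (A j) a (A' j)) (hB : ∀ j, HasValueAt (B j) a (B' j)) (j : ℤ) :
    HasValueAt (rowSum N A B j) a (QPainleve.rowSum N A' B' j) :=
  sum _ fun _ _ => (prod _ fun _ _ => hA _).mul (prod _ fun _ _ => hB _)

/-- Two fractions for `f` can be compared by cross-multiplying in the polynomial ring, so the value
does not depend on the chosen fraction. -/
theorem unique (hf : HasValueAt f a v) (hf' : HasValueAt f a w) : v = w := by
  obtain ⟨n, d, hd, rfl, rfl⟩ := hf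
  obtain ⟨n', d', hd', h, rfl⟩ := hf'
  rw [div_eq_div_iff (ne_zero_of_aeval hd) (ne_zero_of_aeval hd'), ← map_mul, ← map_mul] at h
  have h1 := IsFractionRing.injective (MvPolynomial σ k) (RatField k σ) h
  rw [div_eq_div_iff hd hd', ← map_mul, ← map_mul, h1]

theorem generic (f : RatField k σ) : HasValueAt f (RatField.X k) f := by
  obtain ⟨n, d, hd, rfl⟩ := IsFractionRing.div_surjective (A := MvPolynomial σ k) f
  have e : ∀ p : MvPolynomial σ k,
      MvPolynomial.aeval (RatField.X k : σ → RatField k σ) p =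
        algebraMap (MvPolynomial σ k) (RatField k σ) p := by
    intro p
    have : (MvPolynomial.aeval (RatField.X k : σ → RatField k σ) :
        MvPolynomial σ k →ₐ[k] RatField k σ) =
        IsScalarTower.toAlgHom k (MvPolynomial σ k) (RatField k σ) := by
      ext s
      simp [RatField.X]
    rw [this]
    rfl
  refine ⟨n, d, ?_, rfl, by rw [e, e]⟩
  rw [e]
  exact IsFractionRing.to_map_ne_zero_of_mem_nonZeroDivisors hd

end HasValueAt

/-! ### Birational maps on points. -/

/-- The birational map which substitutes the rational functions `φ(x_s)` for the coordinates `x_s`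
is defined at `a`, and takes `a` to `b`. -/
def MapsPoint (φ : RatField k σ ≃ₐ[k] RatField k σ) (a b : σ → F) : Prop :=
  ∀ s, HasValueAt (φ (RatField.X k s)) a (b s)

namespace MapsPoint

variable {φ ψ : RatField k σ ≃ₐ[k] RatField k σ} {a b c : σ → F}

/-- Automorphisms of functions act contravariantly on points: evaluating `φ f` at `a` is evaluating
`f` at `b`. -/
theorem hasValueAt (h : MapsPoint φ a b) {f : RatField k σ} {v : F} (hf : HasValueAt f b v) :
    HasValueAt (φ f) a v := by
  have hp : ∀ p : MvPolynomial σ k,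
      HasValueAt (φ (algebraMap (MvPolynomial σ k) (RatField k σ) p)) a
        (MvPolynomial.aeval b p) := by
    intro p
    induction p using MvPolynomial.induction_on with
    | C c =>
      rw [← MvPolynomial.algebraMap_eq, ← IsScalarTower.algebraMap_apply, AlgEquiv.commutes,
        MvPolynomial.algebraMap_eq, MvPolynomial.aeval_C]
      exact HasValueAt.const c a
    | add p p' hp hp' =>
      simp only [map_add]
      exact hp.add hp'
    | mul_X p s hp =>
      simp only [map_mul, MvPolynomial.aeval_X]
      exact hp.mul (h s)
  obtain ⟨n, d, hd, rfl, rfl⟩ := hf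
  rw [map_div₀]
  exact (hp n).div (hp d) hd

/-- By contravariance, the left factor of a product moves the point first. -/
theorem mul (h : MapsPoint φ a b) (h' : MapsPoint ψ b c) : MapsPoint (φ * ψ) a c :=
  fun s => h.hasValueAt (h' s)

theorem one (a : σ → F) : MapsPoint (1 : RatField k σ ≃ₐ[k] RatField k σ) a a :=
  fun s => HasValueAt.X s a

/-- Evaluation at the generic point is the identity, so identities between automorphisms follow from
computations with points. -/
theorem eq_one (h : MapsPoint φ (RatField.X k) (RatField.X k)) : φ = 1 := by
  ext f
  exact (HasValueAt.generic (φ f)).unique (h.hasValueAt (HasValueAt.generic f))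

end MapsPoint

end Values

/-! ### The action on points -/

section Points

set_option linter.unusedSectionVars false

variable {k F : Type*} [Field k] [Field F] [Algebra k F] {M N : ℕ} [NeZero M] [NeZero N] (q : kˣ)

/-- The matrix with given rows, the labels of the columns running over `1, …, N`. -/
def rowsPoint (M N : ℕ) (A : ℕ → ℤ → F) (s : Fin M × Fin N) : F := A s.1 ((s.2 : ℕ) + 1)

theorem rowsPoint_congr {A A' : ℕ → ℤ → F} (h : ∀ i < M, A i = A' i) :
    rowsPoint M N A = rowsPoint M N A' := by
  funext s
  simp only [rowsPoint, h _ s.1.2]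

theorem periodic_eq_idx {A : ℤ → F} (hA : Function.Periodic A (N : ℤ)) (j : ℤ) :
    A ((idx N j : ℕ) + 1) = A j := by
  have hN : (0 : ℤ) < N := by exact_mod_cast Nat.pos_of_ne_zero (NeZero.ne N)
  have h2 := hA.int_mul ((j - 1) / N) ((idx N j : ℕ) + 1)
  rw [← h2]
  congr 1
  have := Int.emod_add_mul_ediv (j - 1) N
  have := Int.emod_nonneg (j - 1) hN.ne'
  have e : ((idx N j : ℕ) : ℤ) = (j - 1) % N := by simp only [idx]; omega
  push_cast
  linarith [mul_comm ((j - 1) / (N : ℤ)) N]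

theorem ext_rows {A B : ℤ → F} (hA : Function.Periodic A (N : ℤ))
    (hB : Function.Periodic B (N : ℤ)) (h : ∀ b : Fin N, A ((b : ℕ) + 1) = B ((b : ℕ) + 1)) :
    A = B := by
  funext j
  rw [← periodic_eq_idx hA, ← periodic_eq_idx hB, h]

theorem xx_periodic (i : ℤ) : Function.Periodic (xx M N q 1 i) (N : ℤ) := fun j => by
  rw [xx_add_right]
  simp

theorem rImage_periodic (l i : ℤ) : Function.Periodic (rImage M N q 1 l i) (N : ℤ) := fun j => by
  rw [rImage_add_right]
  simp

theorem xx_eq_X (i : Fin M) (j : ℤ) : xx M N q 1 ((i : ℕ) + 1) j = RatField.X k (i, idx N j) := by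
  rw [← periodic_eq_idx (xx_periodic q _) j, xx_label]

/-- Rows are counted from 0 but labelled from 1: row `i` holds the variables with label `i + 1`, and
the reflection with label `n + 1` acts on rows `n` and `n + 1`. -/
theorem hasValueAt_xx {A : ℕ → ℤ → F} {i : ℕ} (hi : i < M)
    (hA : Function.Periodic (A i) (N : ℤ)) (j : ℤ) :
    HasValueAt (xx M N q 1 (i + 1) j) (rowsPoint M N A) (A i j) := by
  have e := xx_eq_X (k := k) (N := N) q ⟨i, hi⟩ j
  simp only at e
  rw [e, ← periodic_eq_idx hA j]
  exact HasValueAt.X _ _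

theorem modEq_iff {i n : ℕ} (hi : i < M) (hn : n < M) :
    ((i : ℤ) + 1 ≡ n + 1 [ZMOD M]) ↔ i = n := by
  constructor
  · intro h
    have h1 : (i : ℤ) ≡ n [ZMOD M] := Int.ModEq.add_right_cancel' 1 h
    have h2 : i ≡ n [MOD M] := Int.natCast_modEq_iff.mp h1
    exact Nat.ModEq.eq_of_lt_of_lt h2 hi hn
  · rintro rfl
    exact Int.ModEq.refl _

theorem rImage_of_ne {n i : ℕ} (hn : n + 1 < M) (hi : i < M) (h1 : i ≠ n) (h2 : i ≠ n + 1) (j : ℤ) :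
    rImage M N q 1 ((n + 1 : ℕ) : ℤ) (i + 1) j = xx M N q 1 (i + 1) j := by
  have h3 := (modEq_iff hi (show n < M by omega)).not.mpr h1
  have h4 := (modEq_iff hi hn).not.mpr h2
  push_cast at h4 ⊢
  rw [rImage, if_neg h3, if_neg h4]

/-- For `p = 1` the factors `p`, `p⁻¹` in `rImage` disappear, and the reflection is the exchange at
the generic point. -/
theorem isSwap_rImage {n : ℕ} (hn : n + 1 < M) :
    IsSwap N (xx M N q 1 (n + 1)) (xx M N q 1 ((n + 1 : ℕ) + 1))
      (rImage M N q 1 ((n + 1 : ℕ) : ℤ) (n + 1))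
      (rImage M N q 1 ((n + 1 : ℕ) : ℤ) ((n + 1 : ℕ) + 1)) := by
  have h3 : ¬ ((n : ℤ) + 1 + 1 ≡ n + 1 [ZMOD M]) := not_modEq_add_one M (by omega) _
  push_cast
  refine ⟨fun j => PP_ne_zero M N q 1 (by omega) _ j, fun j => ?_, fun j => ?_⟩
  · rw [rImage, if_pos (Int.ModEq.refl _)]
    simp [PP]
  · rw [rImage, if_neg h3, if_pos (Int.ModEq.refl _)]
    simp [PP]

theorem r_X {n : ℕ} (hn : n + 1 < M) (i : Fin M) (b : Fin N) :
    r M N q 1 ((n + 1 : ℕ) : ℤ) (RatField.X k (i, b)) =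
      rImage M N q 1 ((n + 1 : ℕ) : ℤ) ((i : ℕ) + 1) ((b : ℕ) + 1) := by
  rw [r, dif_pos (by omega), substEquiv_X]

theorem omega_X (i : Fin M) (b : Fin N) :
    omega M N q 1 (RatField.X k (i, b)) = xx M N q 1 ((i : ℕ) + 1 + 1) ((b : ℕ) + 1) := by
  rw [omega, substEquiv_X]

theorem r_xx {n i : ℕ} (hn : n + 1 < M) (hi : i < M) (j : ℤ) :
    r M N q 1 ((n + 1 : ℕ) : ℤ) (xx M N q 1 (i + 1) j) =
      rImage M N q 1 ((n + 1 : ℕ) : ℤ) (i + 1) j := by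
  have e := xx_eq_X (k := k) (N := N) q ⟨i, hi⟩ j
  simp only at e
  rw [e, r_X q hn, periodic_eq_idx (rImage_periodic q _ _)]

theorem omega_xx {i : ℕ} (hi : i < M) (j : ℤ) :
    omega M N q 1 (xx M N q 1 (i + 1) j) = xx M N q 1 (i + 1 + 1) j := by
  have e := xx_eq_X (k := k) (N := N) q ⟨i, hi⟩ j
  simp only at e
  rw [e, omega_X q, periodic_eq_idx (xx_periodic q _)]

theorem mapsPoint_r {A A' : ℕ → ℤ → F} {n : ℕ} (hn : n + 1 < M)
    (hA : ∀ i < M, Function.Periodic (A i) (N : ℤ))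
    (hsw : IsSwap N (A n) (A (n + 1)) (A' n) (A' (n + 1)))
    (hne : ∀ i < M, i ≠ n → i ≠ n + 1 → A' i = A i) :
    MapsPoint (r M N q 1 ((n + 1 : ℕ) : ℤ)) (rowsPoint M N A) (rowsPoint M N A') := by
  rintro ⟨i, b⟩
  rw [r_X q hn]
  simp only [rowsPoint]
  have sw := isSwap_rImage (k := k) (N := N) q hn
  have h1 := hasValueAt_xx (N := N) q (show n < M by omega) (hA n (by omega))
  have h2 := hasValueAt_xx (N := N) q hn (hA (n + 1) hn)
  have hP := HasValueAt.rowSum (N := N) h1 h2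
  by_cases e1 : (i : ℕ) = n
  · rw [e1, sw.left, hsw.left]
    exact (h2 _).mul ((hP _).div (hP _) (hsw.ne_zero _))
  by_cases e2 : (i : ℕ) = n + 1
  · rw [e2, sw.right, hsw.right]
    exact (h1 _).mul ((hP _).div (hP _) (hsw.ne_zero _))
  · rw [rImage_of_ne q hn i.2 e1 e2, hne i i.2 e1 e2]
    exact hasValueAt_xx q i.2 (hA i i.2) _

theorem X_eq_rowsPoint : (RatField.X k : Fin M × Fin N → RatField k (Fin M × Fin N)) =
    rowsPoint M N fun i => xx M N q 1 (i + 1) := by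
  funext s
  rw [rowsPoint, xx_label]

/-- The exchange is an involution at the generic point, because distinct rows of variables have
distinct period products. -/
theorem r_mul_self {n : ℕ} (hn : n + 1 < M) :
    r M N q 1 ((n + 1 : ℕ) : ℤ) * r M N q 1 ((n + 1 : ℕ) : ℤ) =
      (1 : RatField k (Fin M × Fin N) ≃ₐ[k] _) := by
  apply MapsPoint.eq_one
  rw [X_eq_rowsPoint q]
  have sw := isSwap_rImage (k := k) (N := N) q hn
  refine MapsPoint.mul (b := rowsPoint M N fun i => rImage M N q 1 ((n + 1 : ℕ) : ℤ) (i + 1))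
    (mapsPoint_r q hn (fun i _ => xx_periodic q _) sw
      fun i hi h1 h2 => funext fun j => rImage_of_ne q hn hi h1 h2 j)
    (mapsPoint_r q hn (fun i _ => rImage_periodic q _ _) ?_
      fun i hi h1 h2 => funext fun j => (rImage_of_ne q hn hi h1 h2 j).symm)
  refine sw.symm (xx_periodic q _) (xx_periodic q _) fun h => ?_
  have := discr_ne_zero (k := k) M N q 1 (by omega) (n + 1) 0
  apply this
  rw [prod_Icc_add (xx_periodic q _), prod_Icc_add (xx_periodic q _)]
  push_cast at h
  simp [h]

theorem r_inv {n : ℕ} (hn : n + 1 < M) :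
    (r M N q 1 ((n + 1 : ℕ) : ℤ) : RatField k (Fin M × Fin N) ≃ₐ[k] _)⁻¹ =
      r M N q 1 ((n + 1 : ℕ) : ℤ) :=
  inv_eq_of_mul_eq_one_left (r_mul_self q hn)

theorem omega_inv_succ {i : ℕ} (hi : i + 1 < M) (j : ℤ) :
    (omega M N q 1)⁻¹ (xx M N q 1 ((i + 1 : ℕ) + 1) j) = xx M N q 1 (i + 1) j := by
  have h := omega_xx (k := k) (N := N) q (show i < M by omega) j
  push_cast
  rw [← h]
  exact AlgEquiv.symm_apply_apply _ _

theorem omega_last (j : ℤ) {i : ℕ} (hi : i + 1 = M) :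
    omega M N q 1 (xx M N q 1 (i + 1) j) = algebraMap k _ (q : k) * xx M N q 1 1 j := by
  rw [omega_xx q (by omega), ← xx_add_left]
  congr 1
  rw [← hi]
  push_cast
  ring

theorem mapsPoint_omega {A A' : ℕ → ℤ → F} (hA' : ∀ i < M, Function.Periodic (A' i) (N : ℤ))
    (h0 : ∀ j, A (M - 1) j = algebraMap k F (q : k) * A' 0 j)
    (h1 : ∀ i, i + 1 < M → A' (i + 1) = A i) :
    MapsPoint (omega M N q 1) (rowsPoint M N A') (rowsPoint M N A) := by
  have hM := Nat.pos_of_ne_zero (NeZero.ne M)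
  rintro ⟨i, b⟩
  rw [← xx_label M N q 1 i b]
  by_cases hi : (i : ℕ) + 1 < M
  · rw [omega_xx q i.2]
    have := hasValueAt_xx (N := N) q hi (hA' _ hi) ((b : ℕ) + 1)
    rw [h1 _ hi] at this
    push_cast at this
    exact this
  · rw [omega_last q _ (show (i : ℕ) + 1 = M by omega), rowsPoint]
    simp only
    rw [show (i : ℕ) = M - 1 by omega, h0]
    refine (HasValueAt.const _ _).mul ?_
    simpa using hasValueAt_xx (N := N) q hM (hA' _ hM) ((b : ℕ) + 1)

theorem mapsPoint_omega_inv {A A' : ℕ → ℤ → F} (hA : ∀ i < M, Function.Periodic (A i) (N : ℤ))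
    (h0 : ∀ j, A' 0 j = (algebraMap k F (q : k))⁻¹ * A (M - 1) j)
    (h1 : ∀ i, i + 1 < M → A' (i + 1) = A i) :
    MapsPoint (omega M N q 1)⁻¹ (rowsPoint M N A) (rowsPoint M N A') := by
  have hM := Nat.pos_of_ne_zero (NeZero.ne M)
  rintro ⟨⟨i, hi⟩, b⟩
  rw [← xx_label M N q 1 _ b, rowsPoint]
  simp only
  cases i with
  | succ i =>
    rw [omega_inv_succ q hi, h1 _ hi]
    exact hasValueAt_xx q (by omega) (hA _ (by omega)) _
  | zero =>
    -- The inverse shift takes label 1 to label 0, and `x^0 = q⁻¹ x^M`.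
    have e : (omega M N q 1)⁻¹ (xx M N q 1 1 ((b : ℕ) + 1)) =
        algebraMap k _ ((q : k)⁻¹) * xx M N q 1 ((M - 1 : ℕ) + 1) ((b : ℕ) + 1) := by
      have h := omega_last (k := k) (N := N) q ((b : ℕ) + 1) (show M - 1 + 1 = M by omega)
      have hinv : algebraMap k (RatField k (Fin M × Fin N)) ((q : k)⁻¹) *
          algebraMap k _ (q : k) = 1 := by rw [← map_mul, inv_mul_cancel₀ q.ne_zero, map_one]
      have h2 : omega M N q 1 (algebraMap k _ ((q : k)⁻¹) *
          xx M N q 1 ((M - 1 : ℕ) + 1) ((b : ℕ) + 1)) = xx M N q 1 1 ((b : ℕ) + 1) := by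
        rw [map_mul, h, AlgEquiv.commutes, ← mul_assoc, hinv, one_mul]
      rw [← h2]
      exact AlgEquiv.symm_apply_apply _ _
    simp only [Nat.cast_zero, zero_add]
    rw [e, h0, ← map_inv₀]
    exact (HasValueAt.const _ _).mul (hasValueAt_xx q (by omega) (hA _ (by omega)) _)

end Points

/-! ### The translations on points -/

section Translations

set_option linter.unusedSectionVars false

variable {k F : Type*} [Field k] [Field F] [Algebra k F] {M N : ℕ} [NeZero M] [NeZero N] (q : kˣ)

/-- The rows `A`, after row `a` has been moved to position `m` by successive exchanges, where it
has become `Z m`, and the rows passed on the way have become `C a, …, C (m - 1)`. -/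
def chainRows (A C Z : ℕ → ℤ → F) (a m i : ℕ) : ℤ → F :=
  if i < a then A i else if i < m then C i else if i = m then Z m else A i

theorem rDesc_succ (a n : ℕ) :
    (rDesc M N q 1 (a + 1) (n + 1) : RatField k (Fin M × Fin N) ≃ₐ[k] _) =
      r M N q 1 ((a + n + 1 : ℕ) : ℤ) * rDesc M N q 1 (a + 1) n := by
  rw [rDesc, show a + 1 + n = a + n + 1 by omega]

theorem periodic_of_chain {A C Z : ℕ → ℤ → F} {a n : ℕ} (han : a + n < M)
    (hA : ∀ i < M, Function.Periodic (A i) (N : ℤ)) (hZa : Z a = A a)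
    (h : ∀ i, a ≤ i → i < a + n → IsSwap N (Z i) (A (i + 1)) (C i) (Z (i + 1))) {i : ℕ}
    (hai : a ≤ i) (hin : i ≤ a + n) : Function.Periodic (Z i) (N : ℤ) := by
  induction i, hai using Nat.le_induction with
  | base => rw [hZa]; exact hA a (by omega)
  | succ i hai ih =>
    exact (h i hai (by omega)).periodic_right (ih (by omega)) (hA _ (by omega))

theorem periodProd_of_chain {A C Z : ℕ → ℤ → F} {a n : ℕ} (han : a + n < M)
    (hA : ∀ i < M, Function.Periodic (A i) (N : ℤ)) (hZa : Z a = A a)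
    (h : ∀ i, a ≤ i → i < a + n → IsSwap N (Z i) (A (i + 1)) (C i) (Z (i + 1))) {i : ℕ}
    (hai : a ≤ i) (hin : i ≤ a + n) : periodProd N (Z i) = periodProd N (A a) := by
  induction i, hai using Nat.le_induction with
  | base => rw [hZa]
  | succ i hai ih =>
    rw [(h i hai (by omega)).periodProd_right
      (periodic_of_chain han hA hZa h hai (by omega)) (hA _ (by omega)), ih (by omega)]

theorem chainRows_periodic {A C Z : ℕ → ℤ → F} {a n : ℕ} (han : a + n < M)
    (hA : ∀ i < M, Function.Periodic (A i) (N : ℤ)) (hZa : Z a = A a)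
    (h : ∀ i, a ≤ i → i < a + n → IsSwap N (Z i) (A (i + 1)) (C i) (Z (i + 1))) (i : ℕ)
    (hi : i < M) : Function.Periodic (chainRows A C Z a (a + n) i) (N : ℤ) := by
  unfold chainRows
  split_ifs with h1 h2 h3
  · exact hA i hi
  · exact (h i (by omega) h2).periodic_left
      (periodic_of_chain han hA hZa h (by omega) (by omega)) (hA _ (by omega))
  · exact periodic_of_chain han hA hZa h (by omega) le_rfl
  · exact hA i hi

theorem chainRows_self {A C Z : ℕ → ℤ → F} {a : ℕ} (hZa : Z a = A a) :
    chainRows A C Z a a = A := by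
  funext i
  unfold chainRows
  split_ifs with h1 h2
  · rfl
  · rw [h2, hZa]
  · rfl

theorem isSwap_chainRows {A C Z : ℕ → ℤ → F} {a n : ℕ}
    (h : IsSwap N (Z (a + n)) (A (a + n + 1)) (C (a + n)) (Z (a + n + 1))) :
    IsSwap N (chainRows A C Z a (a + n) (a + n)) (chainRows A C Z a (a + n) (a + n + 1))
      (chainRows A C Z a (a + n + 1) (a + n)) (chainRows A C Z a (a + n + 1) (a + n + 1)) := by
  have e : ¬ a + n + 1 < a := by omega
  simpa [chainRows, e] using h

theorem chainRows_succ_of_ne {A C Z : ℕ → ℤ → F} {a n i : ℕ} (h1 : i ≠ a + n)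
    (h2 : i ≠ a + n + 1) :
    chainRows A C Z a (a + n + 1) i = chainRows A C Z a (a + n) i := by
  unfold chainRows
  split_ifs <;> first | rfl | omega

/-- On points the reflection labelled `a + 1` comes first, so each further factor carries the former
row `a` one place onward. -/
theorem mapsPoint_rDesc_inv {A C Z : ℕ → ℤ → F} {a n : ℕ} (han : a + n < M)
    (hA : ∀ i < M, Function.Periodic (A i) (N : ℤ)) (hZa : Z a = A a)
    (h : ∀ i, a ≤ i → i < a + n → IsSwap N (Z i) (A (i + 1)) (C i) (Z (i + 1))) :
    MapsPoint (rDesc M N q 1 (a + 1) n)⁻¹ (rowsPoint M N A)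
      (rowsPoint M N (chainRows A C Z a (a + n))) := by
  induction n with
  | zero =>
    rw [add_zero, chainRows_self hZa, rDesc, inv_one]
    exact MapsPoint.one _
  | succ n ih =>
    have h' : ∀ i, a ≤ i → i < a + n → IsSwap N (Z i) (A (i + 1)) (C i) (Z (i + 1)) :=
      fun i h1 h2 => h i h1 (by omega)
    rw [rDesc_succ, mul_inv_rev, r_inv q (by omega)]
    refine (ih (by omega) h').mul (mapsPoint_r q (by omega)
      (chainRows_periodic (by omega) hA hZa h') ?_ fun i _ h1 h2 => chainRows_succ_of_ne h1 h2)
    exact isSwap_chainRows (h (a + n) (by omega) (by omega))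

/-- The chain run backwards. Reversing an exchange requires distinct period products; the carried
row keeps that of row `a`, hence `he`. -/
theorem mapsPoint_rDesc {A C Z : ℕ → ℤ → F} {a n : ℕ} (han : a + n < M)
    (hA : ∀ i < M, Function.Periodic (A i) (N : ℤ)) (hZa : Z a = A a)
    (he : ∀ i, a < i → i ≤ a + n → periodProd N (A a) ≠ periodProd N (A i))
    (h : ∀ i, a ≤ i → i < a + n → IsSwap N (Z i) (A (i + 1)) (C i) (Z (i + 1))) :
    MapsPoint (rDesc M N q 1 (a + 1) n)
      (rowsPoint M N (chainRows A C Z a (a + n))) (rowsPoint M N A) := by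
  induction n with
  | zero =>
    rw [add_zero, chainRows_self hZa, rDesc]
    exact MapsPoint.one _
  | succ n ih =>
    have h' : ∀ i, a ≤ i → i < a + n → IsSwap N (Z i) (A (i + 1)) (C i) (Z (i + 1)) :=
      fun i h1 h2 => h i h1 (by omega)
    rw [rDesc_succ]
    refine (mapsPoint_r q (by omega) (chainRows_periodic han hA hZa h) ?_
      fun i _ h1 h2 => (chainRows_succ_of_ne h1 h2).symm).mul
        (ih (by omega) (fun i h1 h2 => he i h1 (by omega)) h')
    have hper := chainRows_periodic (show a + n < M by omega) hA hZa h'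
    refine (isSwap_chainRows (h (a + n) (by omega) (by omega))).symm (hper _ (by omega))
      (hper _ (by omega)) ?_
    have e1 : chainRows A C Z a (a + n) (a + n) = Z (a + n) := by simp [chainRows]
    have e2 : chainRows A C Z a (a + n) (a + n + 1) = A (a + n + 1) := by simp [chainRows]
    rw [e1, e2, periodProd_of_chain (show a + n < M by omega) hA hZa h' (by omega) le_rfl]
    exact he _ (by omega) (by omega)

/-! ### Every exchange in a chain is defined if the composite is. -/

/-- The row `a`, moved through the following rows by successive exchanges. -/
def carry (N : ℕ) (A : ℕ → ℤ → F) (a : ℕ) : ℕ → ℤ → F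
  -- For indices up to `a` the value is the row of `A` itself; of these, only index `a` matters, as
  -- the start of the recursion.
  | 0 => A 0
  | i + 1 => if i + 1 ≤ a then A (i + 1) else fun j => carry N A a i j *
      (rowSum N (carry N A a i) (A (i + 1)) j / rowSum N (carry N A a i) (A (i + 1)) (j - 1))

/-- The row which row `i + 1` becomes when row `a` moves past it. -/
def passed (N : ℕ) (A : ℕ → ℤ → F) (a i : ℕ) (j : ℤ) : F :=
  A (i + 1) j * (rowSum N (carry N A a i) (A (i + 1)) (j - 1) /
    rowSum N (carry N A a i) (A (i + 1)) j)

theorem carry_self (A : ℕ → ℤ → F) (a : ℕ) : carry N A a a = A a := by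
  cases a with
  | zero => rfl
  | succ a => rw [carry, if_pos le_rfl]

theorem isSwap_carry {A : ℕ → ℤ → F} {a i : ℕ} (hai : a ≤ i)
    (h : ∀ j, rowSum N (carry N A a i) (A (i + 1)) j ≠ 0) :
    IsSwap N (carry N A a i) (A (i + 1)) (passed N A a i) (carry N A a (i + 1)) := by
  refine ⟨h, fun _ => rfl, fun j => ?_⟩
  rw [carry, if_neg (by omega)]

theorem r_X_of_ne {n : ℕ} (hn : n + 1 < M) {i : Fin M} (h1 : (i : ℕ) ≠ n) (h2 : (i : ℕ) ≠ n + 1)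
    (b : Fin N) :
    r M N q 1 ((n + 1 : ℕ) : ℤ) (RatField.X k (i, b)) = RatField.X k (i, b) := by
  rw [r_X q hn, rImage_of_ne q hn i.2 h1 h2, xx_label]

theorem rDesc_inv_X_of_lt {a n : ℕ} (han : a + n < M) {i : Fin M} (hi : a + n < i) (b : Fin N) :
    (rDesc M N q 1 (a + 1) n)⁻¹ (RatField.X k (i, b)) = RatField.X k (i, b) := by
  induction n with
  | zero => rw [rDesc, inv_one]; rfl
  | succ n ih =>
    rw [rDesc_succ, mul_inv_rev, r_inv q (by omega), AlgEquiv.mul_apply,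
      r_X_of_ne q (by omega) (by omega) (by omega), ih (by omega) (by omega)]

/-- A composite may be defined where an intermediate map is not, so the exchanges are recovered
inductively. Once the first `n` are known to be defined, they can be run backwards, which exhibits a
value of the next quotient at the intermediate point; `rowSum_ne_zero_of_mul_eq` then shows that its
denominator does not vanish. -/
theorem isSwap_carry_of_hasValueAt {A : ℕ → ℤ → F} {a n : ℕ} (han : a + n < M)
    (hA : ∀ i < M, Function.Periodic (A i) (N : ℤ))
    (he : ∀ i, a < i → i ≤ a + n → periodProd N (A a) ≠ periodProd N (A i))
    (hdef : ∀ i : Fin M, a ≤ i → (i : ℕ) < a + n → ∀ b : Fin N, ∃ v : F,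
      HasValueAt ((rDesc M N q 1 (a + 1) n)⁻¹ (RatField.X k (i, b))) (rowsPoint M N A) v) :
    ∀ i, a ≤ i → i < a + n →
      IsSwap N (carry N A a i) (A (i + 1)) (passed N A a i) (carry N A a (i + 1)) := by
  induction n with
  | zero => intro i h1 h2; omega
  | succ n ih =>
    have hmap : ∀ f, (rDesc M N q 1 (a + 1) (n + 1))⁻¹ f =
        (rDesc M N q 1 (a + 1) n : RatField k (Fin M × Fin N) ≃ₐ[k] _)⁻¹
          (r M N q 1 ((a + n + 1 : ℕ) : ℤ) f) := by
      intro f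
      rw [rDesc_succ, mul_inv_rev, r_inv q (by omega)]
      rfl
    have h := ih (by omega) (fun i h1 h2 => he i h1 (by omega)) (by
      intro i h1 h2 b
      obtain ⟨v, hv⟩ := hdef i h1 (by omega) b
      rw [hmap, r_X_of_ne q (by omega) (by omega) (by omega)] at hv
      exact ⟨v, hv⟩)
    intro i h1 h2
    by_cases hi : i < a + n
    · exact h i h1 hi
    obtain rfl : i = a + n := by omega
    refine isSwap_carry (by omega) ?_
    have hZ := carry_self (N := N) A a
    have han' : a + n < M := by omega
    have hper := chainRows_periodic han' hA hZ h
    have hmaps := mapsPoint_rDesc q han' hA hZ (fun i h1 h2 => he i h1 (by omega)) h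
    set R := chainRows A (passed N A a) (carry N A a) a (a + n) with hR
    have e1 : R (a + n) = carry N A a (a + n) := by simp [hR, chainRows]
    have e2 : R (a + n + 1) = A (a + n + 1) := by simp [hR, chainRows]
    have pA := hper (a + n) han'
    have pB := hper (a + n + 1) (by omega)
    have v1 := hasValueAt_xx (N := N) q han' pA
    have v2 := hasValueAt_xx (N := N) q (show a + n + 1 < M by omega) pB
    have vP := HasValueAt.rowSum (N := N) v1 v2
    have hpp : periodProd N (R (a + n)) ≠ periodProd N (R (a + n + 1)) := by
      rw [e1, e2, periodProd_of_chain han' hA hZ h (by omega) le_rfl]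
      exact he _ (by omega) (by omega)
    rw [← e1, ← e2]
    intro j
    obtain ⟨v, hv⟩ := hdef ⟨a + n, han'⟩ (by simp) (by simp) (idx N j)
    rw [hmap] at hv
    -- `rDesc` takes the intermediate point `R` back to `A`, so it cancels its inverse and leaves
    -- the last reflection alone, evaluated at `R`.
    have hv' := hmaps.hasValueAt hv
    have e3 : ∀ f, (rDesc M N q 1 (a + 1) n : RatField k (Fin M × Fin N) ≃ₐ[k] _)
        ((rDesc M N q 1 (a + 1) n)⁻¹ f) = f := fun f => AlgEquiv.apply_symm_apply _ _
    rw [e3, r_X q (by omega), periodic_eq_idx (rImage_periodic q _ _)] at hv'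
    have sw := isSwap_rImage (k := k) (N := N) q (show a + n + 1 < M by omega)
    simp only at hv'
    rw [sw.left] at hv'
    have h3 := hv'.mul (vP j)
    have h4 := (v2 j).mul (vP (j - 1))
    have h5 := sw.ne_zero j
    rw [mul_assoc, div_mul_cancel₀ _ h5] at h3
    exact rowSum_ne_zero_of_mul_eq pA pB hpp j v (h3.unique h4)

/-! ### The translations as chains of exchanges. -/

/-- The rows `B` arise from the rows `A` by moving row `l` to the end, multiplying it by `q⁻¹`,
and moving it from the beginning to its position; all exchanges are defined. -/
structure IsTranslation (M N : ℕ) (c : F) (l : ℕ) (A B Z W : ℕ → ℤ → F) : Prop where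
  start : Z l = A l
  after : ∀ i, l ≤ i → i + 1 < M → IsSwap N (Z i) (A (i + 1)) (B (i + 1)) (Z (i + 1))
  shift : ∀ j, W 0 j = c⁻¹ * Z (M - 1) j
  before : ∀ i, i < l → IsSwap N (W i) (A i) (B i) (W (i + 1))
  finish : W l = B l

theorem gamma_inv (l : ℕ) :
    (gamma M N q 1 (l + 1) : RatField k (Fin M × Fin N) ≃ₐ[k] _)⁻¹ =
      (rDesc M N q 1 (l + 1) (M - (l + 1)))⁻¹ *
        ((omega M N q 1)⁻¹ * (rDesc M N q 1 (0 + 1) l)⁻¹) := by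
  rw [gamma, mul_inv_rev, mul_inv_rev, Nat.add_sub_cancel]

theorem IsTranslation.mapsPoint {l : ℕ} (hl : l < M) {A B Z W : ℕ → ℤ → F}
    (hA : ∀ i < M, Function.Periodic (A i) (N : ℤ))
    (h : IsTranslation M N (algebraMap k F (q : k)) l A B Z W) :
    MapsPoint (gamma M N q 1 (l + 1))⁻¹ (rowsPoint M N A) (rowsPoint M N B) := by
  rw [gamma_inv q l]
  have hn : l + (M - (l + 1)) < M := by omega
  have h1 : ∀ i, l ≤ i → i < l + (M - (l + 1)) →
      IsSwap N (Z i) (A (i + 1)) (B (i + 1)) (Z (i + 1)) :=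
    fun i h1 h2 => h.after i h1 (by omega)
  have m1 := mapsPoint_rDesc_inv (C := fun i => B (i + 1)) q hn hA h.start h1
  have p1 := chainRows_periodic (C := fun i => B (i + 1)) hn hA h.start h1
  rw [show l + (M - (l + 1)) = M - 1 by omega] at m1 p1
  set R := chainRows A (fun i => B (i + 1)) Z l (M - 1) with hR
  have hRlast : R (M - 1) = Z (M - 1) := by
    simp only [hR, chainRows, lt_irrefl, if_false, if_true]
    rw [if_neg (by omega)]
  let A' : ℕ → ℤ → F := fun i => if i = 0 then W 0 else R (i - 1)
  have m2 : MapsPoint (omega M N q 1)⁻¹ (rowsPoint M N R) (rowsPoint M N A') := by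
    refine mapsPoint_omega_inv q p1 (fun j => ?_) (fun i _ => ?_)
    · simp only [A', if_true, h.shift, hRlast]
    · simp [A']
  have p2 : ∀ i < M, Function.Periodic (A' i) (N : ℤ) := by
    intro i hi
    by_cases h0 : i = 0
    · intro j
      simp only [A', if_pos h0, h.shift, ← hRlast]
      rw [p1 (M - 1) (by omega)]
    · simp only [A', if_neg h0]
      exact p1 _ (by omega)
  have h3 : ∀ i, 0 ≤ i → i < 0 + l → IsSwap N (W i) (A' (i + 1)) (B i) (W (i + 1)) := by
    intro i _ hi
    have : A' (i + 1) = A i := by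
      simp only [A', Nat.add_sub_cancel, hR, chainRows]
      rw [if_neg (by omega), if_pos (by omega)]
    rw [this]
    exact h.before i (by omega)
  have m3 := mapsPoint_rDesc_inv q (show 0 + l < M by omega) p2 (show W 0 = A' 0 by simp [A']) h3
  have e : rowsPoint M N (chainRows A' B W 0 (0 + l)) = rowsPoint M N B := by
    apply rowsPoint_congr
    intro i hi
    simp only [chainRows, Nat.not_lt_zero, if_false, zero_add]
    split_ifs with c1 c2
    · rfl
    · rw [h.finish, c2]
    · simp only [A', hR, chainRows]
      rw [if_neg (by omega), if_neg (by omega), if_pos (by omega), Nat.sub_add_cancel (by omega)]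
  rw [← e]
  exact m1.mul (m2.mul m3)

/-- The coordinates of `γ⁻¹` in rows after `l` depend only on the first chain, so its exchanges are
defined. Undoing this chain and the rotation then leaves the second chain. `he` and `he'` supply the
distinct determinants for the two chains, the carried one being rescaled by `q^{-N}` in between. -/
theorem exists_isTranslation {l : ℕ} (hl : l < M) {A B : ℕ → ℤ → F}
    (hA : ∀ i < M, Function.Periodic (A i) (N : ℤ))
    (hB : ∀ i < M, Function.Periodic (B i) (N : ℤ))
    (he : ∀ i < M, i ≠ l → periodProd N (A l) ≠ periodProd N (A i))
    (he' : ∀ i < M, i ≠ l →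
      (algebraMap k F (q : k))⁻¹ ^ N * periodProd N (A l) ≠ periodProd N (A i))
    (h : MapsPoint (gamma M N q 1 (l + 1))⁻¹ (rowsPoint M N A) (rowsPoint M N B)) :
    ∃ Z W, IsTranslation M N (algebraMap k F (q : k)) l A B Z W := by
  rw [gamma_inv q l] at h
  have hn : l + (M - (l + 1)) < M := by omega
  have c1 := isSwap_carry_of_hasValueAt (k := k) q hn hA (fun i h1 h2 => he i (by omega) (by omega))
    (by
      rintro ⟨i, hi⟩ h1 h2 b
      simp only at h1 h2
      -- The second chain fixes row `i + 1`, which lies beyond `l`, and the inverse rotation lowers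
      -- it to row `i`.
      have hv := h (⟨i + 1, by omega⟩, b)
      rw [AlgEquiv.mul_apply, AlgEquiv.mul_apply,
        rDesc_inv_X_of_lt q (show 0 + l < M by omega) (by simp; omega), ← xx_label M N q 1,
        omega_inv_succ q (by omega)] at hv
      rw [← xx_label M N q 1]
      exact ⟨_, hv⟩)
  have hZ := carry_self (N := N) A l
  have m1 := mapsPoint_rDesc (k := k) q hn hA hZ (fun i h1 h2 => he i (by omega) (by omega)) c1
  have p1 := chainRows_periodic hn hA hZ c1
  have eZ := periodProd_of_chain (i := M - 1) hn hA hZ c1 (by omega) (by omega)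
  rw [show l + (M - (l + 1)) = M - 1 by omega] at m1 p1 c1
  set Z := carry N A l with hZdef
  set R := chainRows A (passed N A l) Z l (M - 1) with hR
  have hRlast : R (M - 1) = Z (M - 1) := by
    simp only [hR, chainRows, lt_irrefl, if_false, if_true]
    rw [if_neg (by omega)]
  let A' : ℕ → ℤ → F := fun i =>
    if i = 0 then fun j => (algebraMap k F (q : k))⁻¹ * Z (M - 1) j else R (i - 1)
  have hA'succ : ∀ i, A' (i + 1) = R i := fun i => by simp [A']
  have hRlt : ∀ i, i < l → R i = A i := by
    intro i hi
    simp only [hR, chainRows]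
    rw [if_pos hi]
  have p2 : ∀ i < M, Function.Periodic (A' i) (N : ℤ) := by
    intro i hi
    by_cases h0 : i = 0
    · intro j
      simp only [A', if_pos h0, ← hRlast]
      rw [p1 (M - 1) (by omega)]
    · simp only [A', if_neg h0]
      exact p1 _ (by omega)
  have hq0 : algebraMap k F (q : k) ≠ 0 := (map_ne_zero _).mpr q.ne_zero
  have m2 : MapsPoint (omega M N q 1) (rowsPoint M N A') (rowsPoint M N R) := by
    refine mapsPoint_omega q p2 (fun j => ?_) (fun i _ => hA'succ i)
    simp only [A', if_true, hRlast]
    rw [mul_inv_cancel_left₀ hq0]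
  have hfin : ∀ s, HasValueAt ((rDesc M N q 1 (0 + 1) l)⁻¹ (RatField.X k s)) (rowsPoint M N A')
      (rowsPoint M N B s) := by
    intro s
    have hv := m2.hasValueAt (m1.hasValueAt (h s))
    rw [AlgEquiv.mul_apply, AlgEquiv.mul_apply] at hv
    have e1 : ∀ (φ : RatField k (Fin M × Fin N) ≃ₐ[k] RatField k (Fin M × Fin N)) f,
        φ (φ⁻¹ f) = f := fun φ f => AlgEquiv.apply_symm_apply _ _
    rwa [e1, e1] at hv
  have hE : ∀ i, 0 < i → i ≤ 0 + l → periodProd N (A' 0) ≠ periodProd N (A' i) := by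
    intro i h0 hi
    obtain ⟨i, rfl⟩ := Nat.exists_eq_succ_of_ne_zero h0.ne'
    have e0 : periodProd N (A' 0) =
        (algebraMap k F (q : k))⁻¹ ^ N * periodProd N (A l) := by
      rw [← eZ]
      simp [A', periodProd, Finset.prod_mul_distrib]
    rw [e0, hA'succ, hRlt _ (by omega)]
    exact he' i (by omega) (by omega)
  have c2 := isSwap_carry_of_hasValueAt (k := k) q (show 0 + l < M by omega) p2 hE
    (fun i _ _ b => ⟨_, hfin (i, b)⟩)
  have hW := carry_self (N := N) A' 0
  have m3 := mapsPoint_rDesc (k := k) q (show 0 + l < M by omega) p2 hW hE c2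
  have p3 := chainRows_periodic (show 0 + l < M by omega) p2 hW c2
  rw [zero_add] at p3
  -- The exchanges give one set of values at the end of the path and `hfin` gives another; values
  -- are unique.
  have hval : ∀ i < M, chainRows A' (passed N A' 0) (carry N A' 0) 0 l i = B i := by
    intro i hi
    refine ext_rows (p3 i hi) (hB i hi) fun b => ?_
    have hv := m3.hasValueAt (hfin (⟨i, hi⟩, b))
    have e1 : ∀ (φ : RatField k (Fin M × Fin N) ≃ₐ[k] RatField k (Fin M × Fin N)) f,
        φ (φ⁻¹ f) = f := fun φ f => AlgEquiv.apply_symm_apply _ _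
    rw [e1, zero_add] at hv
    exact (HasValueAt.X (k := k) ((⟨i, hi⟩ : Fin M), b) (rowsPoint M N _)).unique hv
  refine ⟨Z, carry N A' 0, hZ, fun i h1 h2 => ?_, fun j => ?_, fun i hi => ?_, ?_⟩
  · have e := hval (i + 1) h2
    simp only [chainRows, Nat.not_lt_zero, if_false] at e
    rw [if_neg (by omega), if_neg (by omega), hA'succ] at e
    simp only [hR, chainRows] at e
    rw [if_neg (by omega), if_pos (by omega)] at e
    rw [← e]
    exact c1 i h1 (by omega)
  · rw [hW]
    simp [A']
  · have e := hval i (by omega)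
    simp only [chainRows, Nat.not_lt_zero, if_false] at e
    rw [if_pos hi] at e
    have := c2 i (by omega) (by omega)
    rwa [hA'succ, hRlt _ hi, e] at this
  · have e := hval l hl
    simp only [chainRows, Nat.not_lt_zero, if_false, lt_irrefl, if_true] at e
    exact e

/-! ### The products of the rows -/

/-- The product of the variables of row `i`. -/
def rowProd (M N : ℕ) [NeZero M] [NeZero N] (q : kˣ) (i : ℕ) : RatField k (Fin M × Fin N) :=
  periodProd N (xx M N q 1 (i + 1))

theorem hasValueAt_rowProd {A : ℕ → ℤ → F} {i : ℕ} (hi : i < M)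
    (hA : Function.Periodic (A i) (N : ℤ)) :
    HasValueAt (rowProd M N q i) (rowsPoint M N A) (periodProd N (A i)) :=
  HasValueAt.prod (f := fun a : ℕ => xx M N q 1 (i + 1) a) (v := fun a : ℕ => A i a)
    (Finset.Icc 1 N) fun _ _ => hasValueAt_xx q hi hA _

theorem r_rowProd {n i : ℕ} (hn : n + 1 < M) (hi : i < M) :
    r M N q 1 ((n + 1 : ℕ) : ℤ) (rowProd M N q i) =
      (rowProd M N q (Equiv.swap n (n + 1) i) : RatField k (Fin M × Fin N)) := by
  have sw := isSwap_rImage (k := k) (N := N) q hn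
  have e : r M N q 1 ((n + 1 : ℕ) : ℤ) (rowProd M N q i) =
      periodProd N (rImage (k := k) M N q 1 ((n + 1 : ℕ) : ℤ) (i + 1)) := by
    simp only [rowProd, periodProd, map_prod]
    exact Finset.prod_congr rfl fun j _ => r_xx q hn hi j
  rw [e]
  by_cases h1 : i = n
  · rw [h1, Equiv.swap_apply_left]
    exact sw.periodProd_left (xx_periodic q _) (xx_periodic q _)
  by_cases h2 : i = n + 1
  · rw [h2, Equiv.swap_apply_right]
    exact sw.periodProd_right (xx_periodic q _) (xx_periodic q _)
  · rw [Equiv.swap_apply_of_ne_of_ne h1 h2, rowProd]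
    congr 1
    funext j
    exact rImage_of_ne q hn hi h1 h2 j

theorem rDesc_rowProd {a n i : ℕ} (hn : a + n < M) (hi : i < M) :
    rDesc M N q 1 (a + 1) n (rowProd M N q i) =
      (rowProd M N q (if i = a then a + n else if a < i ∧ i ≤ a + n then i - 1 else i) :
        RatField k (Fin M × Fin N)) := by
  induction n with
  | zero =>
    have : (if i = a then a + 0 else if a < i ∧ i ≤ a + 0 then i - 1 else i) = i := by
      split_ifs <;> omega
    rw [this]
    rfl
  | succ n ih =>
    rw [rDesc_succ, AlgEquiv.mul_apply, ih (by omega), r_rowProd q (by omega)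
      (by split_ifs <;> omega)]
    congr 1
    rw [Equiv.swap_apply_def]
    split_ifs <;> omega

theorem omega_rowProd {i : ℕ} (hi : i + 1 < M) :
    omega M N q 1 (rowProd M N q i) = (rowProd M N q (i + 1) : RatField k (Fin M × Fin N)) := by
  simp only [rowProd, periodProd, map_prod]
  refine Finset.prod_congr rfl fun j _ => ?_
  rw [omega_xx q (by omega)]
  push_cast
  rfl

theorem omega_rowProd_last {i : ℕ} (hi : i + 1 = M) :
    omega M N q 1 (rowProd M N q i) =
      algebraMap k (RatField k (Fin M × Fin N)) (q : k) ^ N * rowProd M N q 0 := by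
  simp only [rowProd, periodProd, map_prod, omega_last q _ hi, Finset.prod_mul_distrib,
    Finset.prod_const, Nat.card_Icc, Nat.add_sub_cancel]
  simp

/-- Each reflection transposes two neighbouring row products, so the two chains act on them by
cycles, which the rotation undoes. Only the product of row `l` wraps around, and it gains `q ^ N` in
`gamma_rowProd_self`. -/
theorem gamma_rowProd {l i : ℕ} (hl : l < M) (hi : i < M) (h : i ≠ l) :
    gamma M N q 1 (l + 1) (rowProd M N q i) =
      (rowProd M N q i : RatField k (Fin M × Fin N)) := by
  rw [gamma, AlgEquiv.mul_apply, AlgEquiv.mul_apply, rDesc_rowProd q (by omega) hi, if_neg h,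
    Nat.add_sub_cancel, show rDesc M N q 1 1 l = rDesc M N q 1 (0 + 1) l from rfl]
  by_cases h1 : l < i
  · rw [if_pos (by omega), omega_rowProd q (by omega), Nat.sub_add_cancel (by omega),
      rDesc_rowProd q (by omega) hi, if_neg (by omega), if_neg (by omega)]
  · rw [if_neg (by omega), omega_rowProd q (by omega), rDesc_rowProd q (by omega) (by omega),
      if_neg (by omega), if_pos (by omega), Nat.add_sub_cancel]

theorem gamma_rowProd_self {l : ℕ} (hl : l < M) :
    gamma M N q 1 (l + 1) (rowProd M N q l) =
      algebraMap k (RatField k (Fin M × Fin N)) (q : k) ^ N * rowProd M N q l := by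
  rw [gamma, AlgEquiv.mul_apply, AlgEquiv.mul_apply, rDesc_rowProd q (by omega) hl, if_pos rfl,
    Nat.add_sub_cancel, show rDesc M N q 1 1 l = rDesc M N q 1 (0 + 1) l from rfl,
    omega_rowProd_last q (by omega), map_mul, map_pow, AlgEquiv.commutes,
    rDesc_rowProd q (by omega) (by omega), if_pos rfl, zero_add]

/-- Evaluating the row products, eigenvectors of `γ`, at the point needs no exchange to be defined;
it is what yields distinct determinants beforehand. -/
theorem periodProd_eq_of_mapsPoint {l i : ℕ} (hl : l < M) (hi : i < M) {A B : ℕ → ℤ → F}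
    (hA : ∀ i < M, Function.Periodic (A i) (N : ℤ))
    (hB : ∀ i < M, Function.Periodic (B i) (N : ℤ))
    (h : MapsPoint (gamma M N q 1 (l + 1))⁻¹ (rowsPoint M N A) (rowsPoint M N B)) :
    periodProd N (A i) =
      (if i = l then algebraMap k F (q : k) ^ N else 1) * periodProd N (B i) := by
  have h1 := h.hasValueAt (hasValueAt_rowProd q hi (hB i hi))
  have h2 := hasValueAt_rowProd (k := k) (N := N) q hi (hA i hi)
  have e1 : ∀ (φ : RatField k (Fin M × Fin N) ≃ₐ[k] RatField k (Fin M × Fin N)) f,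
      φ⁻¹ (φ f) = f := fun φ f => AlgEquiv.symm_apply_apply _ _
  by_cases c : i = l
  · subst c
    rw [if_pos rfl]
    have e2 := e1 (gamma M N q 1 (i + 1)) (rowProd M N q i)
    rw [gamma_rowProd_self q hl, map_mul, map_pow, AlgEquiv.commutes] at e2
    rw [← e2, ← map_pow] at h2
    rw [← map_pow]
    exact h2.unique ((HasValueAt.const _ _).mul h1)
  · rw [if_neg c, one_mul]
    have e2 := e1 (gamma M N q 1 (l + 1)) (rowProd M N q i)
    rw [gamma_rowProd q hl hi c] at e2
    rw [e2] at h1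
    exact h2.unique h1

end Translations

/-! ### Translations and refactorizations -/

section Dynamics

set_option linter.unusedSectionVars false

variable {k F : Type*} [Field k] [Field F] [Algebra k F] {M N : ℕ} [NeZero M] [NeZero N]

/-- Successive refactorizations push the first row through the product to its right end. -/
theorem foldr_rowOp_chain_right {A B Z : ℕ → ℤ → F} {m d : ℕ} (h0 : Z m = A m)
    (h : ∀ i, m ≤ i → i < m + d → Refactors (Z i) (A (i + 1)) (B (i + 1)) (Z (i + 1)))
    (v : ℤ → F) :
    ((List.range' m (d + 1)).map A).foldr rowOp v =
      ((List.range' (m + 1) d).map B).foldr rowOp (rowOp (Z (m + d)) v) := by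
  induction d generalizing v with
  | zero => simp [h0]
  | succ d ih =>
    rw [List.range'_concat (s := m), List.range'_concat (s := m + 1), List.map_append,
      List.map_append, List.foldr_append, List.foldr_append, ih fun i h1 h2 => h i h1 (by omega)]
    have := (h (m + d) (by omega) (by omega)).rowOp_rowOp v
    simp only [List.map_cons, List.map_nil, List.foldr_cons, List.foldr_nil, one_mul]
    rw [show m + (d + 1) = m + d + 1 by omega, this, show m + 1 + d = m + d + 1 by omega]

theorem foldr_rowOp_chain_left {A B W : ℕ → ℤ → F} {m d : ℕ}
    (h : ∀ i, m ≤ i → i < m + d → Refactors (W i) (A i) (B i) (W (i + 1))) (v : ℤ → F) :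
    rowOp (W m) (((List.range' m d).map A).foldr rowOp v) =
      ((List.range' m d).map B).foldr rowOp (rowOp (W (m + d)) v) := by
  induction d generalizing v with
  | zero => simp
  | succ d ih =>
    rw [List.range'_concat, List.map_append, List.map_append,
      List.foldr_append, List.foldr_append, ih fun i h1 h2 => h i h1 (by omega)]
    have := (h (m + d) (by omega) (by omega)).rowOp_rowOp v
    simp only [List.map_cons, List.map_nil, List.foldr_cons, List.foldr_nil, one_mul]
    rw [this, add_assoc]

theorem periodProd_comp (τ : F ≃ₐ[k] F) (A : ℤ → F) :
    periodProd N (τ ∘ A) = τ (periodProd N A) := by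
  simp [periodProd, map_prod]

theorem periodic_comp (τ : F ≃ₐ[k] F) {A : ℤ → F} (hA : Function.Periodic A (N : ℤ)) :
    Function.Periodic (τ ∘ A) (N : ℤ) := fun j => by
  simp only [Function.comp_apply, hA j]

/-- Quantities on which each `T_l` acts by a scalar, nontrivially only on its own, are distinct. -/
theorem ne_of_eigen {c e f : F} (τ : F ≃ₐ[k] F) (hc : c ≠ 1) (he : e ≠ 0) (h1 : τ e = c * e)
    (h2 : τ f = f) : e ≠ f := by
  rintro rfl
  rw [h1] at h2
  exact hc (mul_right_cancel₀ he (by rw [h2, one_mul]))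

namespace IsTranslation

variable {c : F} {l : ℕ} {A B Z W : ℕ → ℤ → F}

theorem periodic_after (h : IsTranslation M N c l A B Z W) (hl : l < M)
    (hA : ∀ i < M, Function.Periodic (A i) (N : ℤ)) {i : ℕ} (h1 : l ≤ i) (h2 : i < M) :
    Function.Periodic (Z i) (N : ℤ) :=
  periodic_of_chain (C := fun i => B (i + 1)) (n := M - 1 - l) (by omega) hA h.start
    (fun i h1 h2 => h.after i h1 (by omega)) h1 (by omega)

theorem periodProd_after (h : IsTranslation M N c l A B Z W) (hl : l < M)
    (hA : ∀ i < M, Function.Periodic (A i) (N : ℤ)) {i : ℕ} (h1 : l ≤ i) (h2 : i < M) :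
    periodProd N (Z i) = periodProd N (A l) :=
  periodProd_of_chain (C := fun i => B (i + 1)) (n := M - 1 - l) (by omega) hA h.start
    (fun i h1 h2 => h.after i h1 (by omega)) h1 (by omega)

theorem ne_zero_after (h : IsTranslation M N c l A B Z W) (hl : l < M)
    (hA0 : ∀ i < M, ∀ j, A i j ≠ 0) {i : ℕ} (h1 : l ≤ i) (h2 : i < M) (j : ℤ) : Z i j ≠ 0 := by
  induction i, h1 using Nat.le_induction generalizing j with
  | base => rw [h.start]; exact hA0 l hl j
  | succ i h1 ih => exact (h.after i h1 h2).ne_zero_right (ih (by omega)) j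

theorem periodic_before (h : IsTranslation M N c l A B Z W) (hl : l < M)
    (hA : ∀ i < M, Function.Periodic (A i) (N : ℤ)) {i : ℕ} (h1 : i ≤ l) :
    Function.Periodic (W i) (N : ℤ) := by
  induction i with
  | zero =>
    intro j
    rw [h.shift, h.shift, h.periodic_after hl hA (by omega) (by omega)]
  | succ i ih => exact (h.before i h1).periodic_right (ih (by omega)) (hA i (by omega))

theorem periodProd_before (h : IsTranslation M N c l A B Z W) (hl : l < M)
    (hA : ∀ i < M, Function.Periodic (A i) (N : ℤ)) {i : ℕ} (h1 : i ≤ l) :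
    periodProd N (W i) = c⁻¹ ^ N * periodProd N (A l) := by
  induction i with
  | zero =>
    rw [← h.periodProd_after hl hA (i := M - 1) (by omega) (by omega)]
    simp [periodProd, h.shift, Finset.prod_mul_distrib]
  | succ i ih =>
    rw [(h.before i h1).periodProd_right (h.periodic_before hl hA (by omega)) (hA i (by omega)),
      ih (by omega)]

/-- Two of the translations commute, which determines the rows on the way. -/
theorem comp_after_eq {m d : ℕ} {T T' : F ≃ₐ[k] F} (hn : m + d + 1 < M) {Z W Z' W' : ℕ → ℤ → F}
    (h : IsTranslation M N c m A (fun i => T ∘ A i) Z W)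
    (h' : IsTranslation M N c (m + d + 1) A (fun i => T' ∘ A i) Z' W')
    (hA : ∀ i < M, Function.Periodic (A i) (N : ℤ)) (hA0 : ∀ i < M, ∀ j, A i j ≠ 0)
    (hT : ∀ i < M, i ≠ m → T (periodProd N (A i)) = periodProd N (A i))
    (hT' : T' (periodProd N (A m)) = periodProd N (A m))
    (he : ∀ i < M, i ≠ m → periodProd N (A i) ≠ periodProd N (A m))
    (he' : c⁻¹ ^ N * periodProd N (A (m + d + 1)) ≠ periodProd N (A m)) :
    T' ∘ Z (m + d + 1) = Z (m + d) := by
  have hm : m < M := by omega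
  have hZ : ∀ i, m ≤ i → i < M → Function.Periodic (Z i) (N : ℤ) :=
    fun i h1 h2 => h.periodic_after hm hA h1 h2
  have hW : ∀ i, i ≤ m + d + 1 → Function.Periodic (W' i) (N : ℤ) :=
    fun i h1 => h'.periodic_before hn hA h1
  have rZ : ∀ i, m ≤ i → i + 1 < M → Refactors (Z i) (A (i + 1)) (T ∘ A (i + 1)) (Z (i + 1)) :=
    fun i h1 h2 => (h.after i h1 h2).refactors (hZ i h1 (by omega)) (hA _ h2)
  have rW : ∀ i, i < m + d + 1 → Refactors (W' i) (A i) (T' ∘ A i) (W' (i + 1)) :=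
    fun i h1 => (h'.before i h1).refactors (hW i (by omega)) (hA _ (by omega))
  have eA : periodProd N (T' ∘ Z (m + d + 1)) = periodProd N (A m) := by
    rw [periodProd_comp, h.periodProd_after hm hA (by omega) hn, hT']
  symm
  -- Both `T' ∘ Z n` and `Z (n - 1)`, with `n = m + d + 1`, are last factors of the product of the
  -- rows `T' ∘ A i` for `m ≤ i ≤ n`. Both have the determinant of row `m`, which no other factor of
  -- the second factorization shares.
  refine eq_of_foldr_rowOp_eq (periodic_comp T' (hZ _ (by omega) hn)) (hZ _ (by omega) (by omega))
    (fun j => (map_ne_zero T').mpr (h.ne_zero_after hm hA0 (by omega) hn j))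
    (W' m :: (List.range' (m + 1) d).map fun i => T ∘ A i)
    ((List.range' (m + 1) (d + 1)).map fun i => T' ∘ T ∘ A i) ?_ ?_
  · intro C hC
    rw [eA]
    rcases List.mem_cons.mp hC with rfl | hC
    · exact ⟨hW m (by omega), by rw [h'.periodProd_before hn hA (by omega)]; exact he'⟩
    · obtain ⟨i, hi, rfl⟩ := List.mem_map.mp hC
      obtain ⟨h1, h2⟩ := List.mem_range'_1.mp hi
      refine ⟨periodic_comp T (hA i (by omega)), ?_⟩
      rw [periodProd_comp, hT i (by omega) (by omega)]
      exact he i (by omega) (by omega)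
  · intro v
    have e1 := foldr_rowOp_chain_right (A := fun i => T' ∘ A i) (B := fun i => T' ∘ T ∘ A i)
      (Z := fun i => T' ∘ Z i) (m := m) (d := d + 1) (by simp only [h.start])
      (fun i h1 h2 => (refactors_comp T').mpr (rZ i h1 (by omega))) v
    have e2 := foldr_rowOp_chain_left (m := m) (d := d + 1)
      (fun i h1 h2 => rW i (by omega)) v
    have e3 := foldr_rowOp_chain_right (B := fun i => T ∘ A i) (m := m) (d := d) h.start
      (fun i h1 h2 => rZ i h1 (by omega)) v
    -- `e1` pushes row `m` to the right after applying `T'`. `e2` pulls the row carried by the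
    -- second translation out to the left, and `e3` then pushes row `m` to the right.
    rw [show m + (d + 1) = m + d + 1 by omega] at e1 e2
    rw [← e1, List.foldr_cons, ← e3, e2, h'.finish, List.range'_concat, List.map_append,
      List.foldr_append]
    simp only [List.map_cons, List.map_nil, List.foldr_cons, List.foldr_nil, one_mul]
    rw [show m + (d + 1) = m + d + 1 by omega]

end IsTranslation

/-! ### Tails of the commuting evolution, and the two implications for rows. -/

/-- The composition `T_n T_{n+1} ⋯ T_{M-1}`. -/
def tailProd (M : ℕ) (T : ℕ → (F ≃ₐ[k] F)) (n : ℕ) : F ≃ₐ[k] F :=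
  ((List.range' n (M - n)).map T).prod

theorem tailProd_self (T : ℕ → (F ≃ₐ[k] F)) : tailProd M T M = 1 := by
  simp [tailProd]

theorem tailProd_of_lt (T : ℕ → (F ≃ₐ[k] F)) {n : ℕ} (hn : n < M) :
    tailProd M T n = T n * tailProd M T (n + 1) := by
  rw [tailProd, tailProd, show M - n = (M - (n + 1)) + 1 by omega, List.range'_succ,
    List.map_cons, List.prod_cons]

theorem commute_tailProd {T : ℕ → (F ≃ₐ[k] F)} (hT : ∀ m n, Commute (T m) (T n)) (m n : ℕ) :
    Commute (T m) (tailProd M T n) := by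
  refine Commute.list_prod_right _ _ fun x hx => ?_
  obtain ⟨i, _, rfl⟩ := List.mem_map.mp hx
  exact hT m i

/-- The rows `T_{i+1} ⋯ T_{M-1}(U_i)`. -/
def tailRows (M : ℕ) (T : ℕ → (F ≃ₐ[k] F)) (U : ℕ → ℤ → F) (i : ℕ) : ℤ → F :=
  tailProd M T (i + 1) ∘ U i

variable {T : ℕ → (F ≃ₐ[k] F)} {U : ℕ → ℤ → F} {c : F}

theorem tailProd_comp_of_lt {n : ℕ} (hn : n < M) (A : ℤ → F) :
    tailProd M T n ∘ A = T n ∘ tailProd M T (n + 1) ∘ A := by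
  rw [tailProd_of_lt T hn]
  rfl

theorem tailProd_comp_of_lt' (hT : ∀ m n, Commute (T m) (T n)) {n : ℕ} (hn : n < M) (A : ℤ → F) :
    tailProd M T n ∘ A = tailProd M T (n + 1) ∘ T n ∘ A := by
  rw [tailProd_of_lt T hn, (commute_tailProd hT n (n + 1)).eq]
  rfl

theorem comp_tailProd_comp (hT : ∀ m n, Commute (T m) (T n)) (m n : ℕ) (A : ℤ → F) :
    T m ∘ tailProd M T n ∘ A = tailProd M T n ∘ T m ∘ A := by
  funext j
  exact DFunLike.congr_fun (commute_tailProd hT m n).eq (A j)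

theorem tailProd_eq_of_fixed {e : F} {m : ℕ} (hm : m < M) (hT : ∀ m n, Commute (T m) (T n))
    (h : ∀ n < M, n ≠ m → T n e = e) {n : ℕ} (hn : n ≤ M) :
    tailProd M T n e = if n ≤ m then T m e else e := by
  induction hn using Nat.decreasingInduction with
  | self => rw [tailProd_self, if_neg (by omega)]; rfl
  | of_succ n hn ih =>
    rw [tailProd_of_lt T hn, AlgEquiv.mul_apply, ih]
    by_cases h1 : n = m
    · subst h1
      rw [if_neg (by omega), if_pos le_rfl]
    · by_cases h2 : n < m
      · rw [if_pos (by omega), if_pos (by omega)]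
        have := DFunLike.congr_fun (hT n m).eq e
        rw [AlgEquiv.mul_apply, AlgEquiv.mul_apply] at this
        rw [this, h n hn h1]
      · rw [if_neg (by omega), if_neg (by omega), h n hn h1]

/-- An exchange from the Zakharov–Shabat equation for `l` and `i`, moved by the tail of the `T`s
after `i`, is the step in which the carried row passes row `i`. The carried row is always a tail
applied to `U l`; at the rotation, similarity compares the full tail with the empty one. -/
theorem isTranslation_of_refactors (hT : ∀ m n, Commute (T m) (T n)) (hc : c⁻¹ ^ N ≠ 1)
    (hU : ∀ i < M, Function.Periodic (U i) (N : ℤ)) (hU0 : ∀ i < M, ∀ j, U i j ≠ 0)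
    (hne : ∀ m < M, ∀ n < M, m ≠ n → U m ≠ U n)
    (h : ∀ m < M, ∀ n < M, m ≠ n → Refactors (T n ∘ U m) (U n) (T m ∘ U n) (U m))
    (hs : ∀ m < M, ∀ j, tailProd M T 0 (U m j) = c⁻¹ * U m j) {l : ℕ} (hl : l < M) :
    IsTranslation M N c l (tailRows M T U) (fun i => T l ∘ tailRows M T U i)
      (fun i => tailProd M T (i + 1) ∘ U l) (fun i => tailProd M T i ∘ U l) := by
  have h1 : ∀ m < M, ∀ n < M, n ≠ m → T n (periodProd N (U m)) = periodProd N (U m) := by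
    intro m hm n hn hmn
    rw [← periodProd_comp]
    exact (h m hm n hn hmn.symm).periodProd_eq (hU n hn) (hU m hm) (hU0 m hm)
      (hne m hm n hn hmn.symm)
  have h2 : ∀ m < M, T m (periodProd N (U m)) = c⁻¹ ^ N * periodProd N (U m) := by
    intro m hm
    have e1 := tailProd_eq_of_fixed hm hT (h1 m hm) (Nat.zero_le M)
    rw [if_pos (Nat.zero_le m)] at e1
    rw [← e1, ← periodProd_comp]
    simp [periodProd, hs m hm, Finset.prod_mul_distrib]
  have sw : ∀ m < M, ∀ n < M, m ≠ n → IsSwap N (T n ∘ U m) (U n) (T m ∘ U n) (U m) := by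
    intro m hm n hn hmn
    refine (h m hm n hn hmn).isSwap (hU n hn) (hU m hm) (hU0 m hm) ?_
    exact ne_of_eigen (T m) hc (periodProd_ne_zero (hU0 m hm)) (h2 m hm) (h1 n hn m hm hmn)
  refine ⟨rfl, fun i h3 h4 => ?_, fun j => ?_, fun i hi => ?_, ?_⟩
  · have := (sw l hl (i + 1) h4 (by omega)).comp (tailProd M T (i + 2))
    rwa [← tailProd_comp_of_lt' hT h4, ← comp_tailProd_comp hT] at this
  · rw [show M - 1 + 1 = M by omega, tailProd_self]
    exact hs l hl j
  · have := (sw l hl i (by omega) (by omega)).comp (tailProd M T (i + 1))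
    rwa [← tailProd_comp_of_lt' hT (by omega), ← comp_tailProd_comp hT] at this
  · exact tailProd_comp_of_lt hl _

/-- Once the carried rows are known to be tails applied to `U m`, the tail cancels from each
exchange and leaves the Zakharov–Shabat equation, and the rotation gives similarity. -/
theorem refactors_of_isTranslation (hT : ∀ m n, Commute (T m) (T n)) (hc0 : c ≠ 0)
    (hc : c⁻¹ ^ N ≠ 1)
    (hU : ∀ i < M, Function.Periodic (U i) (N : ℤ)) (hU0 : ∀ i < M, ∀ j, U i j ≠ 0)
    (he : ∀ l < M, ∀ i < M, T l (periodProd N (tailRows M T U i)) =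
      (if i = l then c⁻¹ ^ N else 1) * periodProd N (tailRows M T U i))
    (hTc : ∀ l, T l c = c)
    (h : ∀ l < M, ∃ Z W, IsTranslation M N c l (tailRows M T U)
      (fun i => T l ∘ tailRows M T U i) Z W) :
    (∀ m < M, ∀ n < M, m ≠ n → Refactors (T n ∘ U m) (U n) (T m ∘ U n) (U m)) ∧
      ∀ m < M, ∀ j, tailProd M T 0 (U m j) = c⁻¹ * U m j := by
  set X := tailRows M T U with hX
  have hXp : ∀ i < M, Function.Periodic (X i) (N : ℤ) := fun i hi => periodic_comp _ (hU i hi)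
  have hX0 : ∀ i < M, ∀ j, X i j ≠ 0 :=
    fun i hi j => (map_ne_zero (tailProd M T (i + 1))).mpr (hU0 i hi j)
  have he1 : ∀ l < M, ∀ i < M, i ≠ l → T l (periodProd N (X i)) = periodProd N (X i) := by
    intro l hl i hi hil
    rw [he l hl i hi, if_neg hil, one_mul]
  have he2 : ∀ l < M, T l (periodProd N (X l)) = c⁻¹ ^ N * periodProd N (X l) := by
    intro l hl
    rw [he l hl l hl, if_pos rfl]
  have hXe : ∀ i < M, periodProd N (X i) ≠ 0 := fun i hi => periodProd_ne_zero (hX0 i hi)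
  choose! Z W hZW using h
  have hZ : ∀ m < M, ∀ i, m ≤ i → i < M → Z m i = tailProd M T (i + 1) ∘ U m := by
    intro m hm i hmi
    induction i, hmi using Nat.le_induction with
    | base => intro _; rw [(hZW m hm).start]; rfl
    | succ i hmi ih =>
      intro hi
      obtain ⟨d, rfl⟩ := Nat.exists_eq_add_of_le hmi
      have key := (hZW m hm).comp_after_eq hi (hZW _ hi) hXp hX0 (he1 m hm)
        (he1 _ hi m hm (by omega))
        (fun i hi him => (ne_of_eigen (T m) hc (hXe m hm) (he2 m hm) (he1 m hm i hi him)).symm)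
        (ne_of_eigen (T (m + d + 1)) hc
          (mul_ne_zero (pow_ne_zero _ (inv_ne_zero hc0)) (hXe _ hi))
          (by rw [map_mul, he2 _ hi, map_pow, map_inv₀, hTc])
          (he1 _ hi m hm (by omega)))
      rw [ih (by omega), tailProd_comp_of_lt hi] at key
      funext j
      exact (T (m + d + 1)).injective (congrFun key j)
  have hlt : ∀ m n, m < n → n < M → Refactors (T n ∘ U m) (U n) (T m ∘ U n) (U m) := by
    intro m n hmn hn
    obtain ⟨d, rfl⟩ := Nat.exists_eq_add_of_lt hmn
    have hm : m < M := by omega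
    have key := ((hZW m hm).after (m + d) (by omega) hn).refactors
      ((hZW m hm).periodic_after hm hXp (by omega) (by omega)) (hXp _ hn)
    rw [hZ m hm _ (by omega) (by omega), hZ m hm _ (by omega) hn, hX, tailRows,
      tailProd_comp_of_lt' hT hn, comp_tailProd_comp hT] at key
    exact (refactors_comp _).mp key
  have hZS : ∀ m < M, ∀ n < M, m ≠ n → Refactors (T n ∘ U m) (U n) (T m ∘ U n) (U m) := by
    intro m hm n hn hmn
    rcases lt_or_gt_of_ne hmn with h1 | h1
    · exact hlt m n h1 hn
    · exact (hlt n m h1 hm).symm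
  refine ⟨hZS, fun l hl j => ?_⟩
  -- Descending from `finish`: two refactorizations sharing all factors but the first have the same
  -- first factor, as the entries of `X i` are nonzero.
  have hW : ∀ i, i ≤ l → W l i = tailProd M T i ∘ U l := by
    intro i hi
    induction hi using Nat.decreasingInduction with
    | self => rw [(hZW l hl).finish]; exact (tailProd_comp_of_lt hl _).symm
    | of_succ i hi ih =>
      have r1 := ((hZW l hl).before i hi).refactors
        ((hZW l hl).periodic_before hl hXp (by omega)) (hXp _ (by omega))
      have r2 := (refactors_comp (tailProd M T (i + 1))).mpr
        (hZS l hl i (by omega) (by omega))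
      rw [← tailProd_comp_of_lt' hT (by omega), ← comp_tailProd_comp hT] at r2
      rw [ih] at r1
      funext j
      exact mul_right_cancel₀ (hX0 i (by omega) j) ((r1.mul j).trans (r2.mul j).symm)
  have e1 := (hZW l hl).shift j
  rw [hW 0 (Nat.zero_le l), hZ l hl (M - 1) (by omega) (by omega), show M - 1 + 1 = M by omega,
    tailProd_self] at e1
  exact e1

end Dynamics

/-! ### The Zakharov–Shabat equations in terms of rows -/

section Lax

variable {F : Type*} [Field F] {M N : ℕ}

/-- The label following that of `b`, modulo `N`. -/
def nextIdx [NeZero N] (b : Fin N) : Fin N := idx N ((b : ℕ) + 1 + 1)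

theorem idx_add_one [NeZero N] (j : ℤ) : idx N (j + 1) = nextIdx (idx N j) := by
  rw [nextIdx, idx_eq_iff]
  exact (Int.ModEq.add_right 1 ((idx_eq_iff N _ _).mp (idx_label N (idx N j)))).symm

theorem nextIdx_val [NeZero N] (b : Fin N) :
    (nextIdx b : ℕ) = if (b : ℕ) + 1 = N then 0 else (b : ℕ) + 1 := by
  have hb := b.2
  have e : ((b : ℕ) + 1 + 1 - 1 : ℤ) = ((b + 1 : ℕ) : ℤ) := by push_cast; ring
  simp only [nextIdx, idx, e]
  rw [← Int.natCast_mod, Int.toNat_natCast]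
  split_ifs with h
  · rw [h, Nat.mod_self]
  · exact Nat.mod_eq_of_lt (by omega)

theorem cyc_apply [NeZero N] (a b : Fin N) :
    cyc F N a b = if b = nextIdx a then (if (a : ℕ) + 1 = N then Polynomial.X else 1) else 0 := by
  have hb := b.2
  simp only [cyc, Matrix.of_apply, Fin.ext_iff, nextIdx_val]
  by_cases h : (a : ℕ) + 1 = N
  · simp only [h, true_and, if_true]
    rw [if_neg (by omega), zero_add]
  · simp only [h, false_and, if_false, add_zero]
    simp only [eq_comm]

/-- The matrix `diag(a) + s Λ`. -/
def laxMatrix (a : Fin N → F) (s : F) : Matrix (Fin N) (Fin N) F[X] :=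
  Matrix.diagonal (fun j => Polynomial.C (a j)) + Polynomial.C s • cyc F N

theorem laxMatrix_mul_apply (a b : Fin N → F) (s r : F) (i j : Fin N) :
    (laxMatrix a s * laxMatrix b r) i j =
      (if i = j then Polynomial.C (a i * b i) else 0) +
        Polynomial.C (r * a i + s * b j) * cyc F N i j +
          Polynomial.C (s * r) * (cyc F N * cyc F N) i j := by
  simp only [laxMatrix, Matrix.add_mul, Matrix.mul_add, Matrix.add_apply,
    Matrix.diagonal_mul_diagonal, Matrix.diagonal_apply, Matrix.diagonal_mul, Matrix.mul_diagonal,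
    Matrix.smul_apply, Matrix.smul_mul, Matrix.mul_smul, smul_eq_mul, map_mul, map_add]
  ring

/-- The `Λ²` terms agree. What remains is the diagonal and the `Λ` part, separated by position or,
when they share the only entry for `N = 1`, by the power of `z`. -/
theorem laxMatrix_mul_eq_iff [NeZero N] (a b c d : Fin N → F) (s r : F) :
    laxMatrix a s * laxMatrix b r = laxMatrix c r * laxMatrix d s ↔
      ∀ i, a i * b i = c i * d i ∧
        r * a i + s * b (nextIdx i) = s * c i + r * d (nextIdx i) := by
  have entry : ∀ i j, (laxMatrix a s * laxMatrix b r) i j = (laxMatrix c r * laxMatrix d s) i j ↔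
      (if i = j then Polynomial.C (a i * b i) else 0) +
        Polynomial.C (r * a i + s * b j) * cyc F N i j =
      (if i = j then Polynomial.C (c i * d i) else 0) +
        Polynomial.C (s * c i + r * d j) * cyc F N i j := by
    intro i j
    rw [laxMatrix_mul_apply, laxMatrix_mul_apply, mul_comm s r, add_left_inj]
  constructor
  · intro h i
    constructor
    · have h1 := congrArg (Polynomial.coeff · 0) ((entry i i).mp (by rw [h]))
      have hcyc : (cyc F N i i).coeff 0 = 0 := by
        rw [cyc_apply]
        split_ifs with h2 h3
        · simp
        · have := congrArg Fin.val h2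
          rw [nextIdx_val, if_neg h3] at this
          omega
        · simp
      simpa [hcyc] using h1
    · have h1 := (entry i (nextIdx i)).mp (by rw [h])
      rw [cyc_apply, if_pos rfl] at h1
      by_cases h3 : (i : ℕ) + 1 = N
      · rw [if_pos h3] at h1
        have h2 := congrArg (Polynomial.coeff · 1) h1
        simp only [Polynomial.coeff_add, Polynomial.coeff_mul_X, Polynomial.coeff_C_zero] at h2
        have e : ∀ x : F, (if i = nextIdx i then Polynomial.C x else 0).coeff 1 = 0 := by
          intro x
          split_ifs
          · exact Polynomial.coeff_C_of_ne_zero one_ne_zero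
          · simp
        rw [e, e, zero_add, zero_add] at h2
        exact h2
      · have hne : i ≠ nextIdx i := by
          intro h2
          have := congrArg Fin.val h2
          rw [nextIdx_val, if_neg h3] at this
          omega
        rw [if_neg h3, if_neg hne, if_neg hne, zero_add, zero_add, mul_one, mul_one] at h1
        exact Polynomial.C_injective h1
  · intro h
    ext1 i j
    rw [entry, (h i).1]
    congr 1
    rw [cyc_apply]
    split_ifs with h2
    · rw [h2, (h i).2]
    · rw [h2, (h i).2]
    · simp

theorem act_BB {k : Type*} [Field k] [Algebra k F] (τ : F ≃ₐ[k] F) (t : Fin M → F)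
    (u : Fin M → Fin N → F) (m : Fin M) :
    act τ (BB t u m) = laxMatrix (fun j => τ (u m j)) (τ (t m)) := by
  ext1 i j
  simp only [act, BB, laxMatrix, Matrix.map_apply, Matrix.add_apply, Matrix.diagonal_apply,
    Matrix.smul_apply, smul_eq_mul, cyc, Matrix.of_apply, Polynomial.map_add, Polynomial.map_mul,
    Polynomial.map_C]
  congr 1
  · split_ifs <;> simp
  · congr 1
    split_ifs <;> simp

end Lax

/-! ### The equivalence -/

section Main

variable {k F : Type*} [Field k] [Field F] [Algebra k F] {M N : ℕ} [NeZero M] [NeZero N]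

theorem finOfNat_of_lt {i : ℕ} (hi : i < M) : Fin.ofNat M i = ⟨i, hi⟩ :=
  Fin.ext (Nat.mod_eq_of_lt hi)

theorem filter_finRange {n : ℕ} (hn : n ≤ M) :
    (List.finRange M).filter (fun i : Fin M => n ≤ (i : ℕ)) =
      (List.range' n (M - n)).map (Fin.ofNat M) := by
  have e1 : List.finRange M = (List.range M).map (Fin.ofNat M) := by
    rw [← List.map_coe_finRange_eq_range, List.map_map]
    conv_lhs => rw [← List.map_id (List.finRange M)]
    refine List.map_congr_left fun i _ => ?_
    exact (finOfNat_of_lt i.2).symm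
  have e2 : List.range M = List.range' 0 n ++ List.range' n (M - n) := by
    rw [List.range_eq_range']
    have := List.range'_append (s := 0) (m := n) (n := M - n) (step := 1)
    rw [one_mul, zero_add, show n + (M - n) = M by omega] at this
    exact this.symm
  rw [e1, e2, List.map_append, List.filter_append, List.filter_eq_nil_iff.mpr,
    List.filter_eq_self.mpr, List.nil_append]
  · intro a ha
    obtain ⟨i, hi, rfl⟩ := List.mem_map.mp ha
    have := List.mem_range'_1.mp hi
    rw [finOfNat_of_lt (show i < M by omega)]
    simp only [decide_eq_true_eq]
    omega
  · intro a ha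
    obtain ⟨i, hi, rfl⟩ := List.mem_map.mp ha
    have := List.mem_range'_1.mp hi
    rw [finOfNat_of_lt (show i < M by omega)]
    simp only [decide_eq_true_eq]
    omega

/-- The rows `u^{(i)} / t_i`, extended periodically. -/
def normRow (t : Fin M → F) (u : Fin M → Fin N → F) (i : ℕ) (j : ℤ) : F :=
  (t (Fin.ofNat M i))⁻¹ * u (Fin.ofNat M i) (idx N j)

theorem normRow_periodic (t : Fin M → F) (u : Fin M → Fin N → F) (i : ℕ) :
    Function.Periodic (normRow t u i) (N : ℤ) := fun j => by
  rw [normRow, normRow, idx_add]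

theorem normRow_ne_zero {t : Fin M → F} {u : Fin M → Fin N → F} (ht : ∀ i, t i ≠ 0)
    (hu : Nondegenerate t u) (i : ℕ) (j : ℤ) : normRow t u i j ≠ 0 :=
  mul_ne_zero (inv_ne_zero (ht _)) (hu.ne_zero _ _)

theorem normRow_ne {t : Fin M → F} {u : Fin M → Fin N → F} (ht : ∀ i, t i ≠ 0)
    (hu : Nondegenerate t u) {m n : ℕ} (hm : m < M) (hn : n < M) (hmn : m ≠ n) :
    normRow t u m ≠ normRow t u n := by
  intro h
  obtain ⟨b, hb⟩ := hu.ne ⟨m, hm⟩ ⟨n, hn⟩ (by simpa using hmn)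
  apply hb
  have h1 := congrFun h ((b : ℕ) + 1)
  have h2 := ht ⟨m, hm⟩
  have h3 := ht ⟨n, hn⟩
  rw [normRow, normRow, idx_label, finOfNat_of_lt hm, finOfNat_of_lt hn] at h1
  field_simp at h1
  linear_combination h1

variable {T : Fin M → (F ≃ₐ[k] F)} {t : Fin M → F} {u : Fin M → Fin N → F} {c : F}

/-- For `m ≠ n`, `T n` fixes `t m` and `T m` fixes `t n`, so both sides can be divided by `t m * t
n`. -/
theorem zakharovShabat_iff (ht : ∀ i, t i ≠ 0)
    (htT : ∀ m i, T m (t i) = if i = m then c * t i else t i) {m n : ℕ} (hm : m < M) (hn : n < M)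
    (hmn : m ≠ n) :
    act (T ⟨n, hn⟩) (BB t u ⟨m, hm⟩) * BB t u ⟨n, hn⟩ =
        act (T ⟨m, hm⟩) (BB t u ⟨n, hn⟩) * BB t u ⟨m, hm⟩ ↔
      Refactors (T (Fin.ofNat M n) ∘ normRow t u m) (normRow t u n)
        (T (Fin.ofNat M m) ∘ normRow t u n) (normRow t u m) := by
  have e : ∀ m, BB t u m = laxMatrix (u m) (t m) := fun _ => rfl
  have h1 : T ⟨n, hn⟩ (t ⟨m, hm⟩) = t ⟨m, hm⟩ := by
    rw [htT, if_neg (by simpa using hmn)]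
  have h2 : T ⟨m, hm⟩ (t ⟨n, hn⟩) = t ⟨n, hn⟩ := by
    rw [htT, if_neg (by simpa using hmn.symm)]
  rw [act_BB, act_BB, e, e, h1, h2, laxMatrix_mul_eq_iff]
  have q1 := ht ⟨m, hm⟩
  have q2 := ht ⟨n, hn⟩
  have a1 : ∀ j, (T (Fin.ofNat M n) ∘ normRow t u m) j =
      (t ⟨m, hm⟩)⁻¹ * T ⟨n, hn⟩ (u ⟨m, hm⟩ (idx N j)) := by
    intro j
    simp only [Function.comp_apply, normRow, finOfNat_of_lt hm, finOfNat_of_lt hn, map_mul,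
      map_inv₀, h1]
  have a2 : ∀ j, (T (Fin.ofNat M m) ∘ normRow t u n) j =
      (t ⟨n, hn⟩)⁻¹ * T ⟨m, hm⟩ (u ⟨n, hn⟩ (idx N j)) := by
    intro j
    simp only [Function.comp_apply, normRow, finOfNat_of_lt hm, finOfNat_of_lt hn, map_mul,
      map_inv₀, h2]
  have a3 : ∀ j, normRow t u m j = (t ⟨m, hm⟩)⁻¹ * u ⟨m, hm⟩ (idx N j) := by
    intro j; rw [normRow, finOfNat_of_lt hm]
  have a4 : ∀ j, normRow t u n j = (t ⟨n, hn⟩)⁻¹ * u ⟨n, hn⟩ (idx N j) := by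
    intro j; rw [normRow, finOfNat_of_lt hn]
  constructor
  · intro h
    constructor
    · intro j
      rw [a1, a2, a3, a4]
      field_simp
      linear_combination (h (idx N j)).1
    · intro j
      rw [a1, a2, a3, a4, idx_add_one]
      field_simp
      linear_combination (h (idx N j)).2
  · intro h i
    have m1 := h.mul ((i : ℕ) + 1)
    have m2 := h.add ((i : ℕ) + 1)
    rw [a1, a2, a3, a4, idx_label] at m1
    rw [a1, a2, a3, a4, idx_label, show idx N ((i : ℕ) + 1 + 1) = nextIdx i from rfl] at m2
    field_simp at m1 m2
    exact ⟨by linear_combination m1, by linear_combination m2⟩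

theorem tailProd_t (hT : ∀ m n, Commute (T m) (T n))
    (htT : ∀ m i, T m (t i) = if i = m then c * t i else t i) {i n : ℕ} (hi : i < M) (hn : n ≤ M) :
    tailProd M (fun i => T (Fin.ofNat M i)) n (t ⟨i, hi⟩) =
      if n ≤ i then c * t ⟨i, hi⟩ else t ⟨i, hi⟩ := by
  rw [tailProd_eq_of_fixed hi (fun _ _ => hT _ _) (fun m hm hmi => ?_) hn, finOfNat_of_lt hi,
    htT, if_pos rfl]
  rw [finOfNat_of_lt hm, htT, if_neg]
  simpa using hmi.symm

theorem xvar_eq (hT : ∀ m n, Commute (T m) (T n))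
    (htT : ∀ m i, T m (t i) = if i = m then c * t i else t i) :
    xvar T t u = rowsPoint M N (tailRows M (fun i => T (Fin.ofNat M i)) (normRow t u)) := by
  funext s
  obtain ⟨⟨i, hi⟩, b⟩ := s
  have e : (((List.finRange M).filter ((⟨i, hi⟩ : Fin M) < ·)).map T).prod =
      tailProd M (fun i => T (Fin.ofNat M i)) (i + 1) := by
    have h1 : (List.finRange M).filter ((⟨i, hi⟩ : Fin M) < ·) =
        (List.finRange M).filter (fun a : Fin M => i + 1 ≤ (a : ℕ)) := by
      refine List.filter_congr fun a _ => ?_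
      simp only [decide_eq_decide, Fin.lt_def]
      exact Iff.rfl
    rw [h1, filter_finRange hi, List.map_map]
    rfl
  simp only [xvar, rowsPoint, tailRows, Function.comp_apply, normRow]
  rw [e, idx_label, finOfNat_of_lt hi, map_mul, map_inv₀, tailProd_t hT htT hi (by omega),
    if_neg (by omega)]

theorem prod_finRange :
    ((List.finRange M).map T).prod = tailProd M (fun i => T (Fin.ofNat M i)) 0 := by
  have h := filter_finRange (M := M) (Nat.zero_le M)
  rw [List.filter_eq_self.mpr (by simp)] at h
  rw [h, List.map_map]
  rfl

/-- The factor `c⁻¹` comes from the normalization: the full product of the `T`s multiplies `t m` by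
`c`. -/
theorem similarity_iff (hc : c ≠ 0) (ht : ∀ i, t i ≠ 0) (hT : ∀ m n, Commute (T m) (T n))
    (htT : ∀ m i, T m (t i) = if i = m then c * t i else t i) {m : ℕ} (hm : m < M) (j : ℤ) :
    tailProd M (fun i => T (Fin.ofNat M i)) 0 (normRow t u m j) = c⁻¹ * normRow t u m j ↔
      ((List.finRange M).map T).prod (u ⟨m, hm⟩ (idx N j)) = u ⟨m, hm⟩ (idx N j) := by
  have := ht ⟨m, hm⟩
  rw [prod_finRange, normRow, finOfNat_of_lt hm, map_mul, map_inv₀, tailProd_t hT htT hm (by omega),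
    if_pos (Nat.zero_le m), mul_inv, mul_assoc]
  constructor
  · intro h
    exact mul_left_cancel₀ (inv_ne_zero this) (mul_left_cancel₀ (inv_ne_zero hc) h)
  · intro h
    rw [h]

theorem isSolution_iff (hc : c ≠ 0) (ht : ∀ i, t i ≠ 0) (hT : ∀ m n, Commute (T m) (T n))
    (htT : ∀ m i, T m (t i) = if i = m then c * t i else t i) :
    IsSolution T t u ↔
      (∀ m < M, ∀ n < M, m ≠ n → Refactors (T (Fin.ofNat M n) ∘ normRow t u m) (normRow t u n)
        (T (Fin.ofNat M m) ∘ normRow t u n) (normRow t u m)) ∧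
      ∀ m < M, ∀ j, tailProd M (fun i => T (Fin.ofNat M i)) 0 (normRow t u m j) =
        c⁻¹ * normRow t u m j := by
  constructor
  · intro h
    refine ⟨fun m hm n hn hmn => ?_, fun m hm j => ?_⟩
    · exact (zakharovShabat_iff ht htT hm hn hmn).mp (h.zakharovShabat _ _)
    · exact (similarity_iff hc ht hT htT hm j).mpr (h.similarity _ _)
  · rintro ⟨h1, h2⟩
    constructor
    · intro m n
      by_cases hmn : m = n
      · rw [hmn]
      · exact (zakharovShabat_iff ht htT m.2 n.2 (Fin.val_ne_of_ne hmn)).mpr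
          (h1 m m.2 n n.2 (Fin.val_ne_of_ne hmn))
    · intro m j
      have := (similarity_iff hc ht hT htT m.2 ((j : ℕ) + 1)).mp (h2 m m.2 _)
      rwa [idx_label] at this

end Main
end

end QPainleve

open QPainleve in
theorem theorem3 {k : Type*} [Field k] (M N : ℕ) [NeZero M] [NeZero N]
    (q : kˣ) (hq : ∀ n : ℕ, 0 < n → q ^ n ≠ 1)
    {F : Type*} [Field F] [Algebra k F]
    (T : Fin M → (F ≃ₐ[k] F)) (hT : ∀ m n, Commute (T m) (T n))
    (t : Fin M → F) (ht : ∀ i, t i ≠ 0)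
    (htT : ∀ m i, T m (t i) = if i = m then algebraMap k F (q : k) * t i else t i)
    (u : Fin M → Fin N → F) (hu : QPainleve.Nondegenerate t u) :
    QPainleve.IsSolution T t u ↔
      ∀ (l i : Fin M) (j : Fin N),
        QPainleve.HasValueAt
          ((QPainleve.gamma M N q 1 ((l : ℕ) + 1))⁻¹ (QPainleve.RatField.X k (i, j)))
          (QPainleve.xvar T t u)
          (T l (QPainleve.xvar T t u (i, j))) := by
  have hc0 : algebraMap k F (q : k) ≠ 0 := (map_ne_zero _).mpr q.ne_zero
  have hcN : (algebraMap k F (q : k))⁻¹ ^ N ≠ 1 := by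
    rw [inv_pow, ne_eq, inv_eq_one, ← map_pow]
    intro h
    refine hq N (Nat.pos_of_ne_zero (NeZero.ne N)) (Units.ext ?_)
    rw [Units.val_pow_eq_pow_val, Units.val_one]
    exact (algebraMap k F).injective (by rw [h, map_one])
  have hU : ∀ i < M, Function.Periodic (normRow t u i) (N : ℤ) := fun i _ => normRow_periodic t u i
  have hU0 : ∀ i < M, ∀ j, normRow t u i j ≠ 0 := fun i _ => normRow_ne_zero ht hu i
  have hT' : ∀ m n : ℕ, Commute (T (Fin.ofNat M m)) (T (Fin.ofNat M n)) := fun _ _ => hT _ _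
  rw [isSolution_iff hc0 ht hT htT, xvar_eq hT htT]
  set X := tailRows M (fun i => T (Fin.ofNat M i)) (normRow t u) with hX
  have hXp : ∀ i < M, Function.Periodic (X i) (N : ℤ) := fun i hi => periodic_comp _ (hU i hi)
  have hX0 : ∀ i < M, periodProd N (X i) ≠ 0 := fun i hi =>
    periodProd_ne_zero fun j => (map_ne_zero _).mpr (hU0 i hi j)
  have hTXp : ∀ l, ∀ i < M, Function.Periodic (T (Fin.ofNat M l) ∘ X i) (N : ℤ) :=
    fun l i hi => periodic_comp _ (hXp i hi)
  constructor
  · rintro ⟨h1, h2⟩ l i j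
    have h := (isTranslation_of_refactors hT' hcN hU hU0
      (fun m hm n hn hmn => normRow_ne ht hu hm hn hmn) h1 h2 l.2).mapsPoint q l.2 hXp (i, j)
    rwa [finOfNat_of_lt l.2] at h
  · intro h
    have hmaps : ∀ l < M, MapsPoint (gamma M N q 1 (l + 1))⁻¹ (rowsPoint M N X)
        (rowsPoint M N fun i => T (Fin.ofNat M l) ∘ X i) := by
      rintro l hl ⟨i, j⟩
      rw [finOfNat_of_lt hl]
      exact h ⟨l, hl⟩ i j
    -- The row products are eigenvectors of the evolution. As `q ^ N ≠ 1`, this makes them distinct,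
    -- also after rescaling one by `q^{-N}`.
    have he : ∀ l < M, ∀ i < M, T (Fin.ofNat M l) (periodProd N (X i)) =
        (if i = l then (algebraMap k F (q : k))⁻¹ ^ N else 1) * periodProd N (X i) := by
      intro l hl i hi
      have e := periodProd_eq_of_mapsPoint q hl hi hXp (hTXp l) (hmaps l hl)
      rw [periodProd_comp] at e
      split_ifs at e ⊢
      · nth_rewrite 2 [e]
        rw [← mul_assoc, ← mul_pow, inv_mul_cancel₀ hc0, one_pow, one_mul]
      · rw [one_mul] at e ⊢
        exact e.symm
    have he1 : ∀ l < M, ∀ i < M, i ≠ l →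
        T (Fin.ofNat M l) (periodProd N (X i)) = periodProd N (X i) := by
      intro l hl i hi hil
      rw [he l hl i hi, if_neg hil, one_mul]
    have he2 : ∀ l < M, T (Fin.ofNat M l) (periodProd N (X l)) =
        (algebraMap k F (q : k))⁻¹ ^ N * periodProd N (X l) := by
      intro l hl
      rw [he l hl l hl, if_pos rfl]
    refine refactors_of_isTranslation hT' hc0 hcN hU hU0 he (fun l => AlgEquiv.commutes _ _) ?_
    intro l hl
    refine exists_isTranslation q hl hXp (hTXp l)
      (fun i hi hil => ne_of_eigen (T (Fin.ofNat M l)) hcN (hX0 l hl) (he2 l hl) (he1 l hl i hi hil))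
      (fun i hi hil => ne_of_eigen (T (Fin.ofNat M l)) hcN
        (mul_ne_zero (pow_ne_zero _ (inv_ne_zero hc0)) (hX0 l hl)) ?_ (he1 l hl i hi hil))
      (hmaps l hl)
    rw [map_mul, he2 l hl, map_pow, map_inv₀, AlgEquiv.commutes]
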